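/- Let $\xi:\mathbb{R}^d\to\mathbb{R}$ be continuous with $e^{-\xi}$ integrable and let $\Lambda\subset\mathbb{R}^d$ be a (full rank) lattice. Assume that for every $k\in\Lambda$ the number $$e^{-\varepsilon(k)}:=\int_{\mathbb{R}^d}e^{-\xi(x)}e^{-2\pi i\langle k,x\rangle}\,dx$$ is real and $\ge 0$ (so $\varepsilon(k)\in(-\infty,\infty]$), and that $\sum_{k\in\Lambda}e^{-\varepsilon(k)}<\infty$. Let $(\alpha_m)_{m\ge1}$ be real numbers. Put $$F_m(c):=\Bigl(e^{-\alpha_m}\sum_{k\in\Lambda}e^{-\varepsilon(k)m}\Bigr)^{c},\qquad \mathbb{P}_n[\sigma]:=\frac{1}{n!\,h_n}\prod_{m=1}^nF_m(C_m(\sigma))\quad(\sigma\in S_n),$$ where $C_m(\sigma)$ is the number of cycles of length $m$ of $\sigma$ (fixed points being the cycles of length $1$) and $h_n:=\frac1{n!}\sum_{\sigma\in S_n}\prod_{m=1}^nF_m(C_m(\sigma))$. Let $g^{(\alpha)}(t):=\sum_{m\ge1}\frac{e^{-\alpha_m}}{m}t^m$. Let $r>0$ and $\theta>0$, and assume that $g^{(\alpha)}$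 is of class $\mathcal{F}(r,\theta)$, that is: there are $R>r$ and $0<\phi<\pi/2$ such that $g^{(\alpha)}$ is the Taylor series at $0$ of a function $g$ holomorphic in $\Delta_0=\{z\in\mathbb{C}:|z|<R,\ z\ne r,\ |\arg(z-r)|>\phi\}$, and there is a constant $K\in\mathbb{C}$ such that $g(t)=\theta\log\frac{1}{1-t/r}+K+O(t-r)$ as $t\to r$ in $\Delta_0$. Then $\widetilde r:=\min\{e^{\varepsilon(k)}:k\in\Lambda\}$ exists in $(0,\infty)$, the sums $\sum_{k\in\Lambda}e^{-\varepsilon(k)m}$ $(m\ge1)$ converge, $\mathbb{P}_n$ is a probability measure on $S_n$ for every $n$, and for every $b\in\mathbb{N}$, under $\mathbb{P}_n$ and as $n\to\infty$, $$(C_1,C_2,\dots,C_b)\ \xrightarrow{\ d\ }\ (Y_1,\dots,Y_b),$$ where $Y_1,\dots,Y_b$ are independent Poisson random variables with $$\mathbb{E}[Y_m]=\frac{(r\widetilde r)^m}{m}\,e^{-\alpha_m}\sum_{k\in\Lambda}e^{-\varepsilon(k)m}.$$ -/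

import Mathlib

open MeasureTheory ProbabilityTheory Filter Topology
open scoped FourierTransform

noncomputable section

namespace SpatialPerm

/-! ### Cycle counts and the generalized weighted measure on the symmetric group -/

/-- Every subset of the finite group `S_n` is measurable. -/
instance permMeasurableSpace (n : ℕ) : MeasurableSpace (Equiv.Perm (Fin n)) := ⊤

/-- `C_m(σ)`: the number of cycles of length `m` of `σ ∈ S_n` (fixed points are the cycles of
length `1`), i.e. the number of parts equal to `m` in the cycle type of `σ`. -/
def cycleCount {n : ℕ} (m : ℕ) (σ : Equiv.Perm (Fin n)) : ℕ :=
  σ.partition.parts.count m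

/-- The unnormalized weight `∏_{m=1}^n F_m(C_m(σ))`. -/
def permWeight (F : ℕ → ℕ → ℝ) (n : ℕ) (σ : Equiv.Perm (Fin n)) : ℝ :=
  ∏ m ∈ Finset.Icc 1 n, F m (cycleCount m σ)

/-- The normalization constant `h_n(F) = (1 / n!) ∑_{σ ∈ S_n} ∏_{m=1}^n F_m(C_m(σ))`. -/
def normConst (F : ℕ → ℕ → ℝ) (n : ℕ) : ℝ :=
  (1 / (n.factorial : ℝ)) * ∑ σ : Equiv.Perm (Fin n), permWeight F n σ

/-- The generalized weighted measure on `S_n`: the permutation `σ` gets the mass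
`(1 / (n! h_n(F))) ∏_{m=1}^n F_m(C_m(σ))`. -/
def weightedMeasure (F : ℕ → ℕ → ℝ) (n : ℕ) : Measure (Equiv.Perm (Fin n)) :=
  ∑ σ : Equiv.Perm (Fin n),
    ENNReal.ofReal (1 / ((n.factorial : ℝ) * normConst F n) * permWeight F n σ) •
      Measure.dirac σ

/-! ### The weights of spatial random permutations -/

/-- The Fourier integral `∫_{ℝ^d} e^{-ξ(x)} e^{-2πi⟨k,x⟩} dx`. -/
def fourierWeight {d : ℕ} (ξ : EuclideanSpace ℝ (Fin d) → ℝ)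
    (k : EuclideanSpace ℝ (Fin d)) : ℂ :=
  ∫ x, (Real.exp (-ξ x) : ℂ) *
    Complex.exp (-2 * (Real.pi : ℂ) * Complex.I * ((inner ℝ k x : ℝ) : ℂ))

/-- `e^{-ε(k)}`: the value of the Fourier integral at `k` as a real number. It is used only
where the Fourier integral is real and nonnegative (the value `0` stands for `ε(k) = ∞`). -/
def expNegEps {d : ℕ} (ξ : EuclideanSpace ℝ (Fin d) → ℝ)
    (k : EuclideanSpace ℝ (Fin d)) : ℝ :=
  (fourierWeight ξ k).re

/-- The factor `e^{-α_m} ∑_{k ∈ Λ} e^{-ε(k) m}`. -/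
def spatialFactor {d : ℕ} (α : ℕ → ℝ) (ξ : EuclideanSpace ℝ (Fin d) → ℝ)
    (Λ : Submodule ℤ (EuclideanSpace ℝ (Fin d))) (m : ℕ) : ℝ :=
  Real.exp (-α m) * ∑' k : Λ, expNegEps ξ (k : EuclideanSpace ℝ (Fin d)) ^ m

/-- The weights `F_m(c) = (e^{-α_m} ∑_{k ∈ Λ} e^{-ε(k) m})^c`. -/
def spatialF {d : ℕ} (α : ℕ → ℝ) (ξ : EuclideanSpace ℝ (Fin d) → ℝ)
    (Λ : Submodule ℤ (EuclideanSpace ℝ (Fin d))) (m c : ℕ) : ℝ :=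
  spatialFactor α ξ Λ m ^ c

/-- The measure of spatial random permutations on `S_n`. -/
def spatialMeasure {d : ℕ} (α : ℕ → ℝ) (ξ : EuclideanSpace ℝ (Fin d) → ℝ)
    (Λ : Submodule ℤ (EuclideanSpace ℝ (Fin d))) (n : ℕ) : Measure (Equiv.Perm (Fin n)) :=
  weightedMeasure (spatialF α ξ Λ) n

/-- The set `{e^{ε(k)} : k ∈ Λ}` (the points `k` with `e^{-ε(k)} = 0`, where
`e^{ε(k)} = ∞`, contribute no real number). -/
def expEpsSet {d : ℕ} (ξ : EuclideanSpace ℝ (Fin d) → ℝ)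
    (Λ : Submodule ℤ (EuclideanSpace ℝ (Fin d))) : Set ℝ :=
  {x | ∃ k ∈ Λ, 0 < expNegEps ξ k ∧ x = (expNegEps ξ k)⁻¹}

/-- `r̃ = min {e^{ε(k)} : k ∈ Λ}`. -/
def rTilde {d : ℕ} (ξ : EuclideanSpace ℝ (Fin d) → ℝ)
    (Λ : Submodule ℤ (EuclideanSpace ℝ (Fin d))) : ℝ :=
  sInf (expEpsSet ξ Λ)

/-! ### The generating function and the class `𝓕(r, θ)` -/

/-- The power series `g^{(α)}(t) = ∑_{m ≥ 1} (e^{-α_m} / m) t^m`. -/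
def gAlpha (α : ℕ → ℝ) : PowerSeries ℂ :=
  PowerSeries.mk fun m => if m = 0 then 0 else ((Real.exp (-α m) / (m : ℝ) : ℝ) : ℂ)

/-- The domain `Δ₀(r, R, φ) = {z : |z| < R, z ≠ r, |arg (z - r)| > φ}`. -/
def Delta0 (r R φ : ℝ) : Set ℂ :=
  {z | ‖z‖ < R ∧ z ≠ (r : ℂ) ∧ φ < |Complex.arg (z - (r : ℂ))|}

/-- The class `𝓕(r, θ)`: the power series `g` is the expansion at `0` of a function `f` that is
holomorphic in some `Δ₀(r, R, φ)` with `R > r` and `0 < φ < π / 2`, and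
`f(t) = θ log (1 / (1 - t / r)) + K + O(t - r)` as `t → r` in that domain. -/
def IsClassF (g : PowerSeries ℂ) (r θ : ℝ) : Prop :=
  0 < r ∧ 0 ≤ θ ∧
  ∃ R φ : ℝ, r < R ∧ 0 < φ ∧ φ < Real.pi / 2 ∧
  ∃ f : ℂ → ℂ,
    (∀ᶠ t in 𝓝 (0 : ℂ), HasSum (fun n : ℕ => PowerSeries.coeff n g * t ^ n) (f t)) ∧
    DifferentiableOn ℂ f (Delta0 r R φ) ∧
    ∃ K : ℂ,
      (fun t : ℂ => f t - ((θ : ℂ) * Complex.log (1 / (1 - t / (r : ℂ))) + K))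
        =O[𝓝[Delta0 r R φ] (r : ℂ)] (fun t : ℂ => t - (r : ℂ))

end SpatialPerm

end

noncomputable section

namespace SpatialPerm

/-! ### The exponential formula for permutations -/

/-! Write `x m` for the base of the weight, so that `F_m(c) = (x m) ^ c`. The exponential formula
gives `h_n = [t^n] exp(∑ x_m t^m / m)`. Prescribing `C_1, …, C_b` multiplies this series by an
entire function `q`, a product of factors `(x_m t^m / m)^c / c! · exp(-x_m t^m / m)`. If `h_n /
h_{n+1} → ρ`, dominated convergence gives `[t^n](q · ∑ h_k t^k) / h_n → q(ρ)`
(`tendsto_coeff_mul_div`), and `q(ρ)` is exactly the product of Poisson point masses.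

The ratio limit, with `ρ = r r̃`, needs no full asymptotics of `h_n`. The recursion `n h_n = ∑ x_m
h_{n-m}` and `x_m ρ^m → c > 0` suffice (`tendsto_ratio_one`).

The limit of `x_m ρ^m` splits in two. First, `e^{-α_m} r^m → θ`: subtracting the logarithm from `g`
leaves a function whose derivative is bounded on the disc of radius `r`, and Parseval makes the
coefficients of a bounded function, scaled by `r^n`, tend to `0`. Second, `r̃^m ∑ e^{-ε(k)m}` tends
to the number of maximizers of `e^{-ε}`, among which is `k = 0`. -/

/-- The exponential generating series `∑_j f(j) t^{mj} / (m^j j!)` of the cycles of length `m`. -/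
def cycleSeries (m : ℕ) (f : ℕ → ℝ) : PowerSeries ℝ :=
  PowerSeries.mk fun k => if m ∣ k then f (k / m) / ((m : ℝ) ^ (k / m) * ((k / m).factorial : ℝ))
    else 0

lemma coeff_cycleSeries (m k : ℕ) (f : ℕ → ℝ) :
    PowerSeries.coeff k (cycleSeries m f) =
      if m ∣ k then f (k / m) / ((m : ℝ) ^ (k / m) * ((k / m).factorial : ℝ)) else 0 :=
  PowerSeries.coeff_mk _ _

lemma cycleCount_of_two_le {n m : ℕ} (hm : 2 ≤ m) (σ : Equiv.Perm (Fin n)) :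
    cycleCount m σ = σ.cycleType.count m := by
  have : m ≠ 1 := by omega
  simp [cycleCount, Equiv.Perm.parts_partition, Multiset.count_replicate, this.symm]

lemma cycleCount_one {n : ℕ} (σ : Equiv.Perm (Fin n)) :
    cycleCount 1 σ = n - σ.cycleType.sum := by
  have : σ.cycleType.count 1 = 0 := Multiset.count_eq_zero.2 fun h =>
    absurd (Equiv.Perm.two_le_of_mem_cycleType h) (by norm_num)
  simp [cycleCount, Equiv.Perm.parts_partition, this, Equiv.Perm.sum_cycleType]

lemma cycleCount_eq_zero {n m : ℕ} (hm : m ∉ Finset.Icc 1 n) (σ : Equiv.Perm (Fin n)) :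
    cycleCount m σ = 0 := by
  refine Multiset.count_eq_zero.2 fun h => hm ?_
  have h1 := σ.partition.parts_pos h
  have h2 := Multiset.single_le_sum (fun _ _ => Nat.zero_le _) _ h
  rw [σ.partition.parts_sum, Fintype.card_fin] at h2
  exact Finset.mem_Icc.2 ⟨h1, h2⟩

/-- The number of points of `Fin n` that lie on cycles of length `m`, as a function of `m`. -/
def pointsOnCycles {n : ℕ} (σ : Equiv.Perm (Fin n)) : ℕ →₀ ℕ :=
  Finsupp.onFinset (Finset.Icc 1 n) (fun m => m * cycleCount m σ) fun m h => by
    by_contra hm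
    exact h (by rw [cycleCount_eq_zero hm, mul_zero])

lemma pointsOnCycles_mem {n : ℕ} (σ : Equiv.Perm (Fin n)) :
    pointsOnCycles σ ∈ (Finset.Icc 1 n).finsuppAntidiag n := by
  rw [Finset.mem_finsuppAntidiag]
  refine ⟨?_, Finsupp.support_onFinset_subset⟩
  have h := σ.partition.parts_sum
  rw [Finset.sum_multiset_count_of_subset _ (Finset.Icc 1 n)] at h
  · refine Eq.trans ?_ (h.trans (Fintype.card_fin n))
    refine Finset.sum_congr rfl fun m _ => ?_
    simp [pointsOnCycles, cycleCount, mul_comm]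
  · intro m hm
    by_contra h'
    exact (Multiset.count_ne_zero.2 (Multiset.mem_toFinset.1 hm)) (cycleCount_eq_zero h' σ)

/-- The cycle type with `l m / m` cycles of each length `m ≥ 2`. -/
def cycleTypeOf (n : ℕ) (l : ℕ →₀ ℕ) : Multiset ℕ :=
  ∑ m ∈ Finset.Icc 2 n, Multiset.replicate (l m / m) m

lemma count_cycleTypeOf (n m : ℕ) (l : ℕ →₀ ℕ) :
    (cycleTypeOf n l).count m = if m ∈ Finset.Icc 2 n then l m / m else 0 := by
  rw [cycleTypeOf, Multiset.count_sum']
  simp [Multiset.count_replicate]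

lemma Icc_one_eq_insert {n : ℕ} (hn : 1 ≤ n) :
    Finset.Icc 1 n = insert 1 (Finset.Icc 2 n) := by
  ext; simp; omega

lemma sum_cycleTypeOf {n : ℕ} (hn : 1 ≤ n) {l : ℕ →₀ ℕ}
    (hl : l ∈ (Finset.Icc 1 n).finsuppAntidiag n) (hd : ∀ m ∈ Finset.Icc 1 n, m ∣ l m) :
    (cycleTypeOf n l).sum + l 1 = n := by
  have h := (Finset.mem_finsuppAntidiag.1 hl).1
  rw [Icc_one_eq_insert hn, Finset.sum_insert (by simp)] at h
  rw [cycleTypeOf, Multiset.sum_sum]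
  have : ∀ m ∈ Finset.Icc 2 n, (Multiset.replicate (l m / m) m).sum = l m := fun m hm => by
    rw [Multiset.sum_replicate, smul_eq_mul, Nat.div_mul_cancel (hd m (by
      rw [Finset.mem_Icc] at *; omega))]
  rw [Finset.sum_congr rfl this, add_comm]
  exact h

/-- `Equiv.Perm.cycleType` omits fixed points, but their number is forced by the total `n`; hence
lengths `m ≥ 2` determine the whole vector. -/
lemma pointsOnCycles_eq_iff {n : ℕ} (hn : 1 ≤ n) {l : ℕ →₀ ℕ}
    (hl : l ∈ (Finset.Icc 1 n).finsuppAntidiag n) (hd : ∀ m ∈ Finset.Icc 1 n, m ∣ l m)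
    (σ : Equiv.Perm (Fin n)) :
    pointsOnCycles σ = l ↔ σ.cycleType = cycleTypeOf n l := by
  constructor
  · rintro rfl
    ext m
    rw [count_cycleTypeOf]
    split_ifs with h
    · rw [Finset.mem_Icc] at h
      rw [← cycleCount_of_two_le h.1]
      simp [pointsOnCycles, Nat.mul_div_cancel_left _ (show 0 < m by omega)]
    · rw [Multiset.count_eq_zero]
      intro hm
      have h1 := Equiv.Perm.two_le_of_mem_cycleType hm
      have h2 := cycleCount_eq_zero (n := n) (m := m) (by rw [Finset.mem_Icc] at *; omega) σ
      rw [cycleCount_of_two_le h1] at h2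
      exact Multiset.count_ne_zero.2 hm h2
  · intro h
    ext m
    by_cases hm : m ∈ Finset.Icc 1 n
    · have hm' := Finset.mem_Icc.1 hm
      rcases Nat.lt_or_ge m 2 with h2 | h2
      · obtain rfl : m = 1 := by omega
        have := sum_cycleTypeOf hn hl hd
        simp only [pointsOnCycles, Finsupp.onFinset_apply, cycleCount_one, h]
        omega
      · have : cycleCount m σ = l m / m := by
          rw [cycleCount_of_two_le h2, h, count_cycleTypeOf,
            if_pos (Finset.mem_Icc.2 ⟨h2, hm'.2⟩)]
        simp only [pointsOnCycles, Finsupp.onFinset_apply, this]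
        exact Nat.mul_div_cancel' (hd m hm)
    · have h1 : l m = 0 := by
        by_contra h'
        exact hm ((Finset.mem_finsuppAntidiag.1 hl).2 (Finsupp.mem_support_iff.2 h'))
      simp [pointsOnCycles, cycleCount_eq_zero hm, h1]

/-- Cauchy's count of a conjugacy class. The factorial of the number of fixed points, separate in
the count by `cycleType`, becomes the factor `m = 1`. -/
lemma card_pointsOnCycles_eq_mul {n : ℕ} {l : ℕ →₀ ℕ}
    (hl : l ∈ (Finset.Icc 1 n).finsuppAntidiag n) (hd : ∀ m ∈ Finset.Icc 1 n, m ∣ l m) :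
    (Finset.univ.filter fun σ : Equiv.Perm (Fin n) => pointsOnCycles σ = l).card *
      ∏ m ∈ Finset.Icc 1 n, (m ^ (l m / m) * (l m / m).factorial) = n.factorial := by
  rcases Nat.eq_zero_or_pos n with rfl | hn
  · have : l = 0 := by simpa using hl
    subst this
    have : ∀ σ : Equiv.Perm (Fin 0), pointsOnCycles σ = 0 := fun σ => by
      simpa using pointsOnCycles_mem σ
    simp [this]
  have h := Equiv.Perm.card_of_cycleType_mul_eq (Fin n) (cycleTypeOf n l)
  have hs := sum_cycleTypeOf hn hl hd
  rw [Fintype.card_fin, if_pos] at h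
  · simp_rw [pointsOnCycles_eq_iff hn hl hd]
    rw [← h]
    congr 1
    rw [Icc_one_eq_insert hn, Finset.prod_insert (by simp), Finset.prod_mul_distrib]
    have h1 : (cycleTypeOf n l).prod = ∏ m ∈ Finset.Icc 2 n, m ^ (l m / m) := by
      rw [cycleTypeOf, Multiset.prod_sum]
      simp
    have h2 : ∏ m ∈ (cycleTypeOf n l).toFinset, ((cycleTypeOf n l).count m).factorial =
        ∏ m ∈ Finset.Icc 2 n, (l m / m).factorial := by
      have hsub : (cycleTypeOf n l).toFinset ⊆ Finset.Icc 2 n := fun m hm => by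
        by_contra h'
        have := count_cycleTypeOf n m l
        rw [if_neg h'] at this
        exact Multiset.count_ne_zero.2 (Multiset.mem_toFinset.1 hm) this
      rw [Finset.prod_subset hsub]
      · refine Finset.prod_congr rfl fun m hm => ?_
        rw [count_cycleTypeOf, if_pos hm]
      · intro m _ hm
        rw [Multiset.count_eq_zero.2 fun h' => hm (Multiset.mem_toFinset.2 h')]
        rfl
    rw [h1, h2, show n - (cycleTypeOf n l).sum = l 1 by omega]
    simp [mul_assoc]
  · refine ⟨by omega, fun m hm => ?_⟩
    have := count_cycleTypeOf n m l
    by_contra h'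
    rw [if_neg (by rw [Finset.mem_Icc]; omega)] at this
    exact Multiset.count_ne_zero.2 hm this

/-- The exponential formula: the normalization constant is a coefficient of the product of the
generating series of the cycles of length `1, …, n`. -/
theorem normConst_eq_coeff (F : ℕ → ℕ → ℝ) (n : ℕ) :
    normConst F n =
      PowerSeries.coeff n (∏ m ∈ Finset.Icc 1 n, cycleSeries m (F m)) := by
  -- The coefficient of a product is a sum over ways to distribute the degree `n` among the factors;
  -- permutations are grouped by the same index, `pointsOnCycles`.
  rw [PowerSeries.coeff_prod, normConst, one_div,
    ← Finset.sum_fiberwise_of_maps_to (s := Finset.univ)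
      (g := fun σ : Equiv.Perm (Fin n) => pointsOnCycles σ) (fun σ _ => pointsOnCycles_mem σ),
    Finset.mul_sum]
  refine Finset.sum_congr rfl fun l hl => ?_
  -- If divisibility fails for some `m`, the fiber is empty and the `m`-th factor has coefficient
  -- `0`.
  by_cases hd : ∀ m ∈ Finset.Icc 1 n, m ∣ l m
  · have hw : ∀ σ ∈ Finset.univ.filter (fun σ : Equiv.Perm (Fin n) => pointsOnCycles σ = l),
        permWeight F n σ = ∏ m ∈ Finset.Icc 1 n, F m (l m / m) := by
      intro σ hσ
      refine Finset.prod_congr rfl fun m hm => ?_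
      rw [← (Finset.mem_filter.1 hσ).2]
      rw [Finset.mem_Icc] at hm
      simp [pointsOnCycles, Nat.mul_div_cancel_left _ (show 0 < m by omega)]
    rw [Finset.sum_congr rfl hw, Finset.sum_const, nsmul_eq_mul]
    have hc : ∀ m ∈ Finset.Icc 1 n, PowerSeries.coeff (l m) (cycleSeries m (F m)) =
        F m (l m / m) / ((m : ℝ) ^ (l m / m) * ((l m / m).factorial : ℝ)) := fun m hm => by
      rw [coeff_cycleSeries, if_pos (hd m hm)]
    rw [Finset.prod_congr rfl hc, Finset.prod_div_distrib]
    have hcard := congrArg (Nat.cast : ℕ → ℝ) (card_pointsOnCycles_eq_mul hl hd)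
    push_cast at hcard
    have hne : ∏ m ∈ Finset.Icc 1 n, ((m : ℝ) ^ (l m / m) * ((l m / m).factorial : ℝ)) ≠ 0 := by
      refine Finset.prod_ne_zero_iff.2 fun m hm => ?_
      rw [Finset.mem_Icc] at hm
      have : (m : ℝ) ≠ 0 := by norm_cast; omega
      positivity
    have hf : (n.factorial : ℝ) ≠ 0 := by positivity
    rw [← hcard] at hf ⊢
    have := left_ne_zero_of_mul hf
    field_simp
  · push Not at hd
    obtain ⟨m, hm, hdm⟩ := hd
    rw [Finset.prod_eq_zero hm (by rw [coeff_cycleSeries, if_neg hdm]), Finset.filter_eq_empty_iff.2]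
    · simp
    · rintro σ - rfl
      exact hdm (by simp [pointsOnCycles])

/-! ### Cycle series with geometric weights -/

/-- The series `exp (x t^m / m)`. -/
def expCycleSeries (m : ℕ) (x : ℝ) : PowerSeries ℝ := cycleSeries m fun c => x ^ c

lemma coeff_mul_cycleSeries {m : ℕ} (hm : 0 < m) (j : ℕ) (f : ℕ → ℝ) :
    PowerSeries.coeff (m * j) (cycleSeries m f) = f j / ((m : ℝ) ^ j * (j.factorial : ℝ)) := by
  rw [coeff_cycleSeries, if_pos (dvd_mul_right _ _), Nat.mul_div_cancel_left _ hm]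

/-- The differential equation of `exp(x t^m / m)`. It yields both the inverse and the recursion
without composing formal series. -/
lemma derivative_expCycleSeries {m : ℕ} (hm : 0 < m) (x : ℝ) :
    PowerSeries.derivative ℝ (expCycleSeries m x) =
      PowerSeries.C x * PowerSeries.X ^ (m - 1) * expCycleSeries m x := by
  ext k
  rw [PowerSeries.coeff_derivative, mul_assoc, PowerSeries.coeff_C_mul,
    PowerSeries.coeff_X_pow_mul']
  by_cases hd : m ∣ k + 1
  · obtain ⟨j, hj⟩ := hd
    obtain ⟨i, rfl⟩ : ∃ i, j = i + 1 := Nat.exists_eq_succ_of_ne_zero (by rintro rfl; omega)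
    have hk : k = m * i + (m - 1) := by rw [mul_add] at hj; omega
    rw [if_pos (by omega), show k - (m - 1) = m * i by omega, hj, expCycleSeries,
      coeff_mul_cycleSeries hm, coeff_mul_cycleSeries hm]
    have : (k : ℝ) + 1 = m * (i + 1) := by exact_mod_cast hj
    rw [this, Nat.factorial_succ]
    have hm' : (m : ℝ) ≠ 0 := by positivity
    push_cast
    field_simp
    ring
  · rw [expCycleSeries, coeff_cycleSeries, if_neg hd, zero_mul]
    split_ifs with hk
    · rw [coeff_cycleSeries, if_neg, mul_zero]
      rintro ⟨i, hi⟩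
      exact hd ⟨i + 1, by rw [mul_add]; omega⟩
    · simp

lemma constantCoeff_expCycleSeries (m : ℕ) (x : ℝ) :
    PowerSeries.constantCoeff (expCycleSeries m x) = 1 := by
  rw [← PowerSeries.coeff_zero_eq_constantCoeff_apply, expCycleSeries, coeff_cycleSeries]
  simp

lemma expCycleSeries_mul_neg {m : ℕ} (hm : 0 < m) (x : ℝ) :
    expCycleSeries m x * expCycleSeries m (-x) = 1 := by
  apply PowerSeries.derivative.ext
  · rw [Derivation.leibniz, derivative_expCycleSeries hm, derivative_expCycleSeries hm, map_neg,
      PowerSeries.derivative_one]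
    simp only [smul_eq_mul]
    ring
  · simp [constantCoeff_expCycleSeries]

lemma coeff_mul_congr {R : Type*} [CommSemiring R] {n : ℕ} {A B B' : PowerSeries R}
    (h : ∀ k ≤ n, PowerSeries.coeff k B = PowerSeries.coeff k B') :
    PowerSeries.coeff n (A * B) = PowerSeries.coeff n (A * B') := by
  rw [PowerSeries.coeff_mul, PowerSeries.coeff_mul]
  refine Finset.sum_congr rfl fun p hp => ?_
  rw [h p.2 (by have := Finset.HasAntidiagonal.mem_antidiagonal.1 hp; omega)]

/-- The coefficients of `exp (∑_m x_m t^m / m)`. -/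
def expCoeff (x : ℕ → ℝ) (n : ℕ) : ℝ :=
  PowerSeries.coeff n (∏ m ∈ Finset.Icc 1 n, expCycleSeries m (x m))

/-- The factor of index `m` is `1 + O(t^m)`, so factors beyond `n` do not affect degree `n`; finite
products can replace the infinite one. -/
lemma coeff_prod_expCycleSeries (x : ℕ → ℝ) {n N : ℕ} (h : n ≤ N) :
    PowerSeries.coeff n (∏ m ∈ Finset.Icc 1 N, expCycleSeries m (x m)) = expCoeff x n := by
  induction N, h using Nat.le_induction with
  | base => rfl
  | succ N hN ih =>
    rw [← ih, ← Finset.insert_Icc_right_eq_Icc_add_one (by omega : 1 ≤ N + 1),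
      Finset.prod_insert (by simp), mul_comm]
    conv_rhs => rw [← mul_one (∏ m ∈ Finset.Icc 1 N, _)]
    refine coeff_mul_congr fun k hk => ?_
    rcases Nat.eq_zero_or_pos k with rfl | hk0
    · simp [constantCoeff_expCycleSeries]
    · rw [expCycleSeries, coeff_cycleSeries, if_neg fun hd => by
        have := Nat.le_of_dvd hk0 hd; omega, PowerSeries.coeff_one, if_neg (by omega)]

lemma derivative_prod_expCycleSeries (x : ℕ → ℝ) (N : ℕ) :
    PowerSeries.derivative ℝ (∏ m ∈ Finset.Icc 1 N, expCycleSeries m (x m)) =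
      (∑ m ∈ Finset.Icc 1 N, PowerSeries.C (x m) * PowerSeries.X ^ (m - 1)) *
        ∏ m ∈ Finset.Icc 1 N, expCycleSeries m (x m) := by
  induction N with
  | zero => simp
  | succ N ih =>
    rw [← Finset.insert_Icc_right_eq_Icc_add_one (by omega : 1 ≤ N + 1),
      Finset.prod_insert (by simp), Finset.sum_insert (by simp), Derivation.leibniz, ih,
      derivative_expCycleSeries (by omega)]
    simp only [smul_eq_mul]
    ring

/-- Compare coefficients of `t^(n-1)` in the logarithmic derivative identity. -/
theorem mul_expCoeff (x : ℕ → ℝ) (n : ℕ) :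
    (n : ℝ) * expCoeff x n = ∑ m ∈ Finset.Icc 1 n, x m * expCoeff x (n - m) := by
  rcases Nat.eq_zero_or_pos n with rfl | hn
  · simp
  obtain ⟨k, rfl⟩ : ∃ k, n = k + 1 := ⟨n - 1, by omega⟩
  have h := congrArg (PowerSeries.coeff k) (derivative_prod_expCycleSeries x (k + 1))
  rw [PowerSeries.coeff_derivative, Finset.sum_mul, map_sum] at h
  push_cast
  rw [mul_comm]
  refine h.trans (Finset.sum_congr rfl fun m hm => ?_)
  rw [Finset.mem_Icc] at hm
  rw [mul_assoc, PowerSeries.coeff_C_mul, PowerSeries.coeff_X_pow_mul', if_pos (by omega),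
    coeff_prod_expCycleSeries x (by omega), show k - (m - 1) = k + 1 - m by omega]

lemma expCoeff_pos {x : ℕ → ℝ} (hx : ∀ m, 1 ≤ m → 0 < x m) (n : ℕ) : 0 < expCoeff x n := by
  induction n using Nat.strong_induction_on with
  | _ n ih =>
    rcases Nat.eq_zero_or_pos n with rfl | hn
    · simp [expCoeff]
    · have h : 0 < (n : ℝ) * expCoeff x n := by
        rw [mul_expCoeff]
        refine Finset.sum_pos (fun m hm => ?_) ⟨1, by simp; omega⟩
        rw [Finset.mem_Icc] at hm
        exact mul_pos (hx m hm.1) (ih _ (by omega))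
      exact pos_of_mul_pos_right h (by positivity)

lemma hasSum_cycleSeries {m : ℕ} (hm : 0 < m) {f : ℕ → ℝ} {t s : ℝ}
    (h : HasSum (fun j => f j / ((m : ℝ) ^ j * (j.factorial : ℝ)) * (t ^ m) ^ j) s) :
    HasSum (fun k => PowerSeries.coeff k (cycleSeries m f) * t ^ k) s := by
  have hinj : Function.Injective fun j => m * j := fun a b hab => Nat.eq_of_mul_eq_mul_left hm hab
  refine (hinj.hasSum_iff fun k hk => ?_).1 ?_
  · rw [coeff_cycleSeries, if_neg fun ⟨j, hj⟩ => hk ⟨j, hj.symm⟩, zero_mul]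
  · convert h using 2 with j
    simp only [Function.comp]
    rw [coeff_mul_cycleSeries hm, pow_mul]

lemma hasSum_expCycleSeries {m : ℕ} (hm : 0 < m) (x t : ℝ) :
    HasSum (fun k => PowerSeries.coeff k (expCycleSeries m x) * t ^ k)
      (Real.exp (x * t ^ m / m)) := by
  refine hasSum_cycleSeries hm ?_
  have := NormedSpace.expSeries_div_hasSum_exp (x * t ^ m / m : ℝ)
  rw [← Real.exp_eq_exp_ℝ] at this
  have hm' : (m : ℝ) ≠ 0 := by positivity
  refine Eq.mp ?_ this
  congr 1
  funext j
  rw [div_pow, mul_pow]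
  field_simp

lemma abs_coeff_cycleSeries (m k : ℕ) (f : ℕ → ℝ) :
    |PowerSeries.coeff k (cycleSeries m f)| =
      PowerSeries.coeff k (cycleSeries m fun c => |f c|) := by
  rw [coeff_cycleSeries, coeff_cycleSeries]
  split_ifs
  · rw [abs_div, abs_of_nonneg (a := (m : ℝ) ^ _ * _) (by positivity)]
  · simp

lemma summable_abs_expCycleSeries {m : ℕ} (hm : 0 < m) (x M : ℝ) :
    Summable fun k => |PowerSeries.coeff k (expCycleSeries m x)| * M ^ k := by
  simp only [expCycleSeries, abs_coeff_cycleSeries, abs_pow]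
  exact (hasSum_expCycleSeries hm |x| M).summable

lemma hasSum_cycleSeries_single {m : ℕ} (hm : 0 < m) (c : ℕ) (x t : ℝ) :
    HasSum (fun k => PowerSeries.coeff k (cycleSeries m fun j => if j = c then x ^ j else 0) * t ^ k)
      ((x * t ^ m / m) ^ c / (c.factorial : ℝ)) := by
  refine hasSum_cycleSeries hm ?_
  have hm' : (m : ℝ) ≠ 0 := by positivity
  have h := hasSum_ite_eq c ((x * t ^ m / m) ^ c / (c.factorial : ℝ))
  convert h using 2 with j
  split_ifs with hj
  · subst hj
    rw [div_pow, mul_pow]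
    field_simp
  · simp

lemma summable_abs_cycleSeries_single {m : ℕ} (hm : 0 < m) (c : ℕ) (x M : ℝ) :
    Summable fun k =>
      |PowerSeries.coeff k (cycleSeries m fun j => if j = c then x ^ j else 0)| * M ^ k := by
  simp only [abs_coeff_cycleSeries]
  convert (hasSum_cycleSeries_single hm c |x| M).summable using 6 with k
  split_ifs <;> simp

/-! ### Limits of ratios of coefficients -/

/-- Toeplitz averaging: each individual weight vanishes in the limit, so finitely many `v m` are
negligible, and the rest are small against total mass at most `1`. -/
lemma tendsto_sum_mul_sub_of_tendsto_zero {v : ℕ → ℝ} {p : ℕ → ℕ → ℝ}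
    (hv : Tendsto v atTop (𝓝 0)) (hp0 : ∀ n m, 0 ≤ p n m)
    (hp : ∀ m, Tendsto (fun n => p n m) atTop (𝓝 0))
    (hp1 : ∀ n, ∑ m ∈ Finset.Icc 1 n, p n m ≤ 1) :
    Tendsto (fun n => ∑ m ∈ Finset.Icc 1 n, v m * p n m) atTop (𝓝 0) := by
  rw [Metric.tendsto_atTop]
  intro ε hε
  obtain ⟨M, hM⟩ := Metric.tendsto_atTop.1 hv (ε / 2) (by positivity)
  have h1 : Tendsto (fun n => ∑ m ∈ Finset.range M, |v m| * p n m) atTop (𝓝 0) := by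
    have := tendsto_finsetSum (Finset.range M) fun m _ => (hp m).const_mul |v m|
    simpa using this
  obtain ⟨N, hN⟩ := Metric.tendsto_atTop.1 h1 (ε / 2) (by positivity)
  refine ⟨N, fun n hn => ?_⟩
  have h2 := hN n hn
  rw [dist_zero_right, Real.norm_eq_abs] at h2 ⊢
  have h3 : ∀ m ∈ Finset.Icc 1 n, |v m * p n m| ≤
      (if m < M then |v m| * p n m else 0) + ε / 2 * p n m := by
    intro m _
    rw [abs_mul, abs_of_nonneg (hp0 n m)]
    split_ifs with h
    · have := mul_nonneg (half_pos hε).le (hp0 n m)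
      linarith
    · rw [zero_add]
      have := hM m (by omega)
      rw [dist_zero_right, Real.norm_eq_abs] at this
      exact mul_le_mul_of_nonneg_right this.le (hp0 n m)
  calc |∑ m ∈ Finset.Icc 1 n, v m * p n m|
      ≤ ∑ m ∈ Finset.Icc 1 n, |v m * p n m| := Finset.abs_sum_le_sum_abs _ _
    _ ≤ _ := Finset.sum_le_sum h3
    _ = (∑ m ∈ Finset.Icc 1 n with m < M, |v m| * p n m) + ε / 2 * ∑ m ∈ Finset.Icc 1 n, p n m := by
        rw [Finset.sum_add_distrib, Finset.sum_filter, Finset.mul_sum]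
    _ ≤ (∑ m ∈ Finset.range M, |v m| * p n m) + ε / 2 * 1 := by
        gcongr
        · exact fun m _ _ => mul_nonneg (abs_nonneg _) (hp0 n m)
        · exact fun m hm => Finset.mem_range.2 (Finset.mem_filter.1 hm).2
        · exact hp1 n
    _ < ε := by linarith [le_abs_self (∑ m ∈ Finset.range M, |v m| * p n m)]

lemma sum_Icc_one_sub (w : ℕ → ℝ) (n : ℕ) :
    ∑ m ∈ Finset.Icc 1 n, w (n - m) = ∑ j ∈ Finset.range n, w j := by
  refine Finset.sum_nbij' (fun m => n - m) (fun j => n - j) ?_ ?_ ?_ ?_ ?_ <;>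
    simp <;> intros <;> omega

/-- If `n w_n = ∑_{m=1}^n u_m w_{n-m}` with `u_m → c > 0`, then `w_n / w_{n+1} → 1`. -/
theorem tendsto_ratio_one {w u : ℕ → ℝ} {c : ℝ} (hc : 0 < c) (hw : ∀ n, 0 < w n)
    (hrec : ∀ n : ℕ, (n : ℝ) * w n = ∑ m ∈ Finset.Icc 1 n, u m * w (n - m))
    (hu : Tendsto u atTop (𝓝 c)) :
    Tendsto (fun n => w n / w (n + 1)) atTop (𝓝 1) := by
  set S : ℕ → ℝ := fun n => ∑ j ∈ Finset.range n, w j with hS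
  have hSpos : ∀ n, 1 ≤ n → 0 < S n := fun n hn =>
    Finset.sum_pos (fun j _ => hw j) ⟨0, by simp; omega⟩
  have hSmono : Monotone S := fun a b hab =>
    Finset.sum_le_sum_of_subset_of_nonneg (by simpa using hab) fun j _ _ => (hw j).le
  obtain ⟨A, hA⟩ : ∃ A, ∀ m, |u m| ≤ A := by
    obtain ⟨A, hA⟩ := (Metric.isBounded_range_of_tendsto u hu).exists_norm_le
    exact ⟨A, fun m => hA _ ⟨m, rfl⟩⟩
  have hA0 : 0 ≤ A := (abs_nonneg _).trans (hA 0)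
  have hle : ∀ n : ℕ, (n : ℝ) * w n ≤ A * S n := fun n => by
    rw [hrec, show S n = _ from (sum_Icc_one_sub w n).symm, Finset.mul_sum]
    exact Finset.sum_le_sum fun m _ =>
      mul_le_mul_of_nonneg_right ((le_abs_self _).trans (hA m)) (hw _).le
  -- From `n w_n ≤ A S_n` and monotonicity of `S`, the weight is at most `A / (n - m)`.
  have hsmall : ∀ m, Tendsto (fun n => if m ≤ n then w (n - m) / S n else 0) atTop (𝓝 0) := by
    intro m
    have h1 : Tendsto (fun n : ℕ => A / ((n - m : ℕ) : ℝ)) atTop (𝓝 0) :=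
      (tendsto_const_nhds (x := A)).div_atTop
        (tendsto_natCast_atTop_atTop.comp (tendsto_sub_atTop_nat m))
    refine squeeze_zero' (Eventually.of_forall fun n => ?_) ?_ h1
    · split_ifs
      · exact div_nonneg (hw _).le (Finset.sum_nonneg fun j _ => (hw j).le)
      · exact le_rfl
    · filter_upwards [eventually_gt_atTop m] with n hn
      rw [if_pos hn.le, div_le_div_iff₀ (hSpos n (by omega)) (by exact_mod_cast Nat.sub_pos_of_lt hn),
        mul_comm]
      exact (hle _).trans (mul_le_mul_of_nonneg_left (hSmono (Nat.sub_le _ _)) hA0)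
  -- Divided by `S n`, the recursion is an average of the `u m`, with weights of sum `1` for `n ≥ 1`
  -- (at `n = 0` the sum is `0`).
  have hlim : Tendsto (fun n : ℕ => (n : ℝ) * w n / S n) atTop (𝓝 c) := by
    have hv : Tendsto (fun m => u m - c) atTop (𝓝 0) := by
      simpa using hu.sub_const c
    have h := tendsto_sum_mul_sub_of_tendsto_zero hv
      (p := fun n m => if m ≤ n then w (n - m) / S n else 0) (fun n m => by
        split_ifs
        · exact div_nonneg (hw _).le (Finset.sum_nonneg fun j _ => (hw j).le)
        · exact le_rfl) hsmall (fun n => by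
        rw [Finset.sum_congr rfl fun m hm => if_pos (Finset.mem_Icc.1 hm).2, ← Finset.sum_div,
          sum_Icc_one_sub]
        exact div_self_le_one _)
    have h2 := h.add_const c
    rw [zero_add] at h2
    refine h2.congr' ?_
    filter_upwards [eventually_ge_atTop 1] with n hn
    have hSn := (hSpos n hn).ne'
    have : ∀ m ∈ Finset.Icc 1 n, (u m - c) * (if m ≤ n then w (n - m) / S n else 0) =
        u m * w (n - m) / S n - c / S n * w (n - m) := fun m hm => by
      rw [if_pos (Finset.mem_Icc.1 hm).2]
      ring
    rw [Finset.sum_congr rfl this, Finset.sum_sub_distrib, ← Finset.sum_div, ← hrec,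
      ← Finset.mul_sum, sum_Icc_one_sub]
    change _ - c / S n * S n + c = _
    field_simp
    ring
  have hstep : Tendsto (fun n => S (n + 1) / S n) atTop (𝓝 1) := by
    have h := (hsmall 0).const_add 1
    rw [add_zero] at h
    refine h.congr' ?_
    filter_upwards [eventually_ge_atTop 1] with n hn
    have := (hSpos n hn).ne'
    simp only [hS, Finset.sum_range_succ]
    simp only [hS] at this
    rw [if_pos (Nat.zero_le _), Nat.sub_zero]
    field_simp
  have hnat : Tendsto (fun n : ℕ => (n : ℝ) / ((n : ℝ) + 1)) atTop (𝓝 1) := tendsto_natCast_div_add_atTop 1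
  have hlim1 := (hlim.comp (tendsto_add_atTop_nat 1))
  -- `w_n / w_{n+1}` is `n w_n / S_n` divided by the product of `(n+1) w_{n+1} / S_{n+1}`, `S_{n+1}
  -- / S_n` and `n / (n+1)`.
  have hall := (hlim.div (hlim1.mul (hstep.mul hnat)) (by simp [hc.ne']))
  rw [mul_one, mul_one, div_self hc.ne'] at hall
  refine hall.congr' ?_
  filter_upwards [eventually_ge_atTop 1] with n hn
  have h1 := (hSpos n hn).ne'
  have h2 := (hSpos (n + 1) (by omega)).ne'
  have h3 := (hw n).ne'
  have h4 := (hw (n + 1)).ne'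
  have h5 : (n : ℝ) ≠ 0 := by norm_cast; omega
  have h6 : (n : ℝ) + 1 ≠ 0 := by positivity
  simp only [Function.comp, Pi.div_apply]
  push_cast
  field_simp

/-- The recursion is homogeneous in degree, so it persists for `h_n ρ^n` and `x_m ρ^m`. -/
theorem tendsto_expCoeff_ratio {x : ℕ → ℝ} {ρ c : ℝ} (hx : ∀ m, 1 ≤ m → 0 < x m) (hρ : 0 < ρ)
    (hc : 0 < c) (h : Tendsto (fun m => x m * ρ ^ m) atTop (𝓝 c)) :
    Tendsto (fun n => expCoeff x n / expCoeff x (n + 1)) atTop (𝓝 ρ) := by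
  have hr := tendsto_ratio_one (w := fun n => expCoeff x n * ρ ^ n) hc
    (fun n => mul_pos (expCoeff_pos hx n) (pow_pos hρ n)) (fun n => by
      rw [← mul_assoc, mul_expCoeff, Finset.sum_mul]
      refine Finset.sum_congr rfl fun m hm => ?_
      rw [← Nat.add_sub_cancel' (Finset.mem_Icc.1 hm).2, pow_add, Nat.add_sub_cancel' (Finset.mem_Icc.1 hm).2]
      ring) h
  have h2 := hr.const_mul ρ
  rw [mul_one] at h2
  refine h2.congr fun n => ?_
  have := (expCoeff_pos hx (n + 1)).ne'
  rw [pow_succ]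
  field_simp

/-- Multiplication by an entire series, on the level of coefficients. -/
theorem tendsto_coeff_mul_div {h : ℕ → ℝ} {ρ L : ℝ} {q B : PowerSeries ℝ} (hpos : ∀ n, 0 < h n)
    (hρ : Tendsto (fun n => h n / h (n + 1)) atTop (𝓝 ρ))
    (hq : ∀ M, Summable fun k => |PowerSeries.coeff k q| * M ^ k)
    (hB : Tendsto (fun n => PowerSeries.coeff n B / h n) atTop (𝓝 L)) {s : ℝ}
    (hs : HasSum (fun k => PowerSeries.coeff k q * ρ ^ k) s) :
    Tendsto (fun n => PowerSeries.coeff n (q * B) / h n) atTop (𝓝 (s * L)) := by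
  obtain ⟨M, hM⟩ : ∃ M, ∀ n, |h n / h (n + 1)| ≤ M := by
    obtain ⟨A, hA⟩ := (Metric.isBounded_range_of_tendsto _ hρ).exists_norm_le
    exact ⟨A, fun m => hA _ ⟨m, rfl⟩⟩
  obtain ⟨K, hK⟩ : ∃ K, ∀ n, |PowerSeries.coeff n B / h n| ≤ K := by
    obtain ⟨A, hA⟩ := (Metric.isBounded_range_of_tendsto _ hB).exists_norm_le
    exact ⟨A, fun m => hA _ ⟨m, rfl⟩⟩
  have hM0 : 0 ≤ M := (abs_nonneg _).trans (hM 0)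
  -- The bound `M` may exceed `ρ`, which is why `q` must converge absolutely at every radius.
  have hbd : ∀ i n, h n / h (n + i) ≤ M ^ i := by
    intro i n
    induction i with
    | zero => simp [(hpos n).ne']
    | succ i ih =>
      have e : h n / h (n + (i + 1)) = h n / h (n + i) * (h (n + i) / h (n + i + 1)) := by
        have := (hpos (n + i)).ne'
        rw [← add_assoc]
        field_simp
      rw [e, pow_succ]
      exact mul_le_mul ih ((le_abs_self _).trans (hM _)) (div_nonneg (hpos _).le (hpos _).le)
        (pow_nonneg hM0 _)
  have hlim : ∀ i, Tendsto (fun n => h n / h (n + i)) atTop (𝓝 (ρ ^ i)) := by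
    intro i
    induction i with
    | zero => simp [fun n => (hpos n).ne']
    | succ i ih =>
      rw [pow_succ]
      refine (ih.mul (hρ.comp (tendsto_add_atTop_nat i))).congr fun n => ?_
      have := (hpos (n + i)).ne'
      simp only [Function.comp, ← add_assoc]
      field_simp
  set T : ℕ → ℕ → ℝ := fun n i => if i ≤ n then
    PowerSeries.coeff i q * (PowerSeries.coeff (n - i) B / h (n - i) * (h (n - i) / h n)) else 0
    with hT
  have hlim' : ∀ i, Tendsto (fun n => T n i) atTop (𝓝 (PowerSeries.coeff i q * (L * ρ ^ i))) := by
    intro i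
    rw [← tendsto_add_atTop_iff_nat i]
    refine ((hB.mul (hlim i)).const_mul _).congr fun n => ?_
    simp [hT]
  have hsum : ∀ n, PowerSeries.coeff n (q * B) / h n = ∑' i, T n i := by
    intro n
    rw [tsum_eq_sum (s := Finset.range (n + 1)) (fun i hi => by
      simp only [hT]; rw [if_neg]; simpa using hi), PowerSeries.coeff_mul,
      Finset.Nat.sum_antidiagonal_eq_sum_range_succ
        (fun i j => PowerSeries.coeff i q * PowerSeries.coeff j B), Finset.sum_div]
    refine Finset.sum_congr rfl fun i hi => ?_
    have := (hpos (n - i)).ne'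
    simp only [hT]
    rw [if_pos (by simpa [Nat.lt_succ_iff] using hi)]
    field_simp
  simp_rw [hsum]
  have hval : s * L = ∑' i, PowerSeries.coeff i q * (L * ρ ^ i) := by
    rw [← hs.tsum_eq, ← tsum_mul_right]
    refine tsum_congr fun i => by ring
  rw [hval]
  refine tendsto_tsum_of_dominated_convergence
    (bound := fun i => K * (|PowerSeries.coeff i q| * M ^ i)) ((hq M).mul_left K) hlim'
    (Eventually.of_forall fun n i => ?_)
  have hK0 : 0 ≤ K := (abs_nonneg _).trans (hK 0)
  simp only [hT]
  split_ifs with hi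
  · have h1 := hbd i (n - i)
    rw [Nat.sub_add_cancel hi] at h1
    have h2 : 0 ≤ h (n - i) / h n := div_nonneg (hpos _).le (hpos _).le
    rw [Real.norm_eq_abs, abs_mul, abs_mul, abs_of_nonneg h2]
    calc _ ≤ |PowerSeries.coeff i q| * (K * M ^ i) :=
          mul_le_mul_of_nonneg_left (mul_le_mul (hK _) h1 h2 hK0) (abs_nonneg _)
      _ = _ := by ring
  · rw [norm_zero]
    positivity

/-! ### Coefficients of bounded holomorphic functions -/

/-- Parseval on the circle of radius `s`, applied to a Taylor polynomial long enough that the tail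
is at most `1`; this tail is the `+ 1` in the bound. -/
lemma sum_sq_norm_coeff_le {a : ℕ → ℂ} {F : ℂ → ℂ} {r M s : ℝ}
    (ha : ∀ z, ‖z‖ < r → HasSum (fun n => a n * z ^ n) (F z)) (hM : ∀ z, ‖z‖ < r → ‖F z‖ ≤ M)
    (hs0 : 0 < s) (hs : s < r) (K : ℕ) :
    ∑ k ∈ Finset.range K, ‖a k‖ ^ 2 * (s ^ k) ^ 2 ≤ (M + 1) ^ 2 := by
  have hsum : Summable fun k => ‖a k‖ * s ^ k := by
    have h := (ha (s : ℂ) (by simpa [abs_of_pos hs0] using hs)).summable.norm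
    simpa [abs_of_pos hs0] using h
  have htail := tendsto_sum_nat_add fun k => ‖a k‖ * s ^ k
  obtain ⟨N, hN, hKN⟩ := ((htail.eventually (gt_mem_nhds one_pos)).and
    (eventually_ge_atTop K)).exists
  set p : Polynomial ℂ := ∑ k ∈ Finset.range N, Polynomial.monomial k (a k * (s : ℂ) ^ k) with hp
  have hcoeff : ∀ k, p.coeff k = if k < N then a k * (s : ℂ) ^ k else 0 := by
    intro k
    rw [hp, Polynomial.finsetSum_coeff]
    simp [Polynomial.coeff_monomial]
  have hev : ∀ u : ℂ, ‖u‖ = 1 → ‖p.eval u‖ ≤ M + 1 := by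
    intro u hu
    have hz : ‖(s : ℂ) * u‖ < r := by simpa [hu, abs_of_pos hs0] using hs
    have h1 := ha _ hz
    have h2 : p.eval u = ∑ k ∈ Finset.range N, a k * ((s : ℂ) * u) ^ k := by
      rw [hp, Polynomial.eval_finsetSum]
      refine Finset.sum_congr rfl fun k _ => ?_
      rw [Polynomial.eval_monomial, mul_pow, mul_assoc]
    have h3 := h1.summable.sum_add_tsum_nat_add N
    rw [h1.tsum_eq, ← h2] at h3
    have hnorm : ∀ k, ‖a k * ((s : ℂ) * u) ^ k‖ = ‖a k‖ * s ^ k := fun k => by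
      simp [hu, abs_of_pos hs0]
    have h4 : ‖∑' k, a (k + N) * ((s : ℂ) * u) ^ (k + N)‖ ≤ 1 := by
      refine (norm_tsum_le_tsum_norm ?_).trans ?_
      · simp_rw [hnorm]
        exact (summable_nat_add_iff N).2 hsum
      · simp_rw [hnorm]
        exact hN.le
    calc ‖p.eval u‖ = ‖F (s * u) - ∑' k, a (k + N) * ((s : ℂ) * u) ^ (k + N)‖ := by
          rw [← h3]; simp
      _ ≤ M + 1 := (norm_sub_le _ _).trans (add_le_add (hM _ hz) h4)
  have hpars := p.sum_sq_norm_coeff_eq_circleAverage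
  have hle : Real.circleAverage (fun z => ‖p.eval z‖ ^ 2) 0 1 ≤ (M + 1) ^ 2 := by
    refine Real.circleAverage_mono_on_of_le_circle ?_ fun x hx => ?_
    · refine ContinuousOn.circleIntegrable' ?_
      exact (Continuous.continuousOn (by fun_prop))
    · exact pow_le_pow_left₀ (norm_nonneg _) (hev x (by simpa using hx)) 2
  refine le_trans ?_ (hpars.le.trans hle)
  calc ∑ k ∈ Finset.range K, ‖a k‖ ^ 2 * (s ^ k) ^ 2
      = ∑ k ∈ Finset.range K, ‖p.coeff k‖ ^ 2 := by
        refine Finset.sum_congr rfl fun k hk => ?_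
        rw [hcoeff, if_pos ((Finset.mem_range.1 hk).trans_le hKN)]
        simp [mul_pow, abs_of_pos hs0]
    _ ≤ ∑ k ∈ Finset.range K ∪ p.support, ‖p.coeff k‖ ^ 2 :=
        Finset.sum_le_sum_of_subset_of_nonneg Finset.subset_union_left fun _ _ _ => by positivity
    _ = ∑ k ∈ p.support, ‖p.coeff k‖ ^ 2 := by
        refine (Finset.sum_subset Finset.subset_union_right fun k _ hk => ?_).symm
        rw [Polynomial.notMem_support_iff.1 hk]
        simp

/-- Letting `s ↑ r` in the finite Parseval bounds makes `‖a k‖² r^(2k)` summable, so its terms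
vanish. -/
theorem tendsto_coeff_of_bounded {a : ℕ → ℂ} {F : ℂ → ℂ} {r M : ℝ} (hr : 0 < r)
    (ha : ∀ z, ‖z‖ < r → HasSum (fun n => a n * z ^ n) (F z)) (hM : ∀ z, ‖z‖ < r → ‖F z‖ ≤ M) :
    Tendsto (fun n => a n * (r : ℂ) ^ n) atTop (𝓝 0) := by
  have hK : ∀ K, ∑ k ∈ Finset.range K, ‖a k‖ ^ 2 * (r ^ k) ^ 2 ≤ (M + 1) ^ 2 := by
    intro K
    have hc : Tendsto (fun s : ℝ => ∑ k ∈ Finset.range K, ‖a k‖ ^ 2 * (s ^ k) ^ 2) (𝓝[<] r)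
        (𝓝 (∑ k ∈ Finset.range K, ‖a k‖ ^ 2 * (r ^ k) ^ 2)) :=
      ((by fun_prop : Continuous fun s : ℝ => ∑ k ∈ Finset.range K, ‖a k‖ ^ 2 * (s ^ k) ^ 2).tendsto
        r).mono_left nhdsWithin_le_nhds
    refine le_of_tendsto hc ?_
    filter_upwards [Ioo_mem_nhdsLT hr] with s hs
    exact sum_sq_norm_coeff_le ha hM hs.1 hs.2 K
  have hsum : Summable fun k => ‖a k‖ ^ 2 * (r ^ k) ^ 2 :=
    summable_of_sum_range_le (fun k => by positivity) hK
  have h0 := (hsum.tendsto_atTop_zero).sqrt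
  rw [Real.sqrt_zero] at h0
  rw [tendsto_zero_iff_norm_tendsto_zero]
  refine h0.congr fun k => ?_
  rw [← mul_pow, Real.sqrt_sq (by positivity)]
  simp [abs_of_pos hr]

/-! ### The domain `Δ₀` -/

/-- Cosine decreases on `[0, π]`. The inequality trades the discontinuous `arg` for continuous
functions and excludes `z = r` by itself. -/
lemma mem_Delta0_iff {r R φ : ℝ} (h0 : 0 < φ) (h1 : φ < Real.pi / 2) (z : ℂ) :
    z ∈ Delta0 r R φ ↔ ‖z‖ < R ∧ (z - r).re < ‖z - r‖ * Real.cos φ := by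
  by_cases hz : z = r
  · simp [Delta0, hz]
  have hz' : z - r ≠ 0 := sub_ne_zero.2 hz
  have key : φ < |Complex.arg (z - r)| ↔ (z - r).re < ‖z - r‖ * Real.cos φ := by
    rw [← Real.strictAntiOn_cos.lt_iff_gt (a := |Complex.arg (z - r)|) (b := φ)
      ⟨abs_nonneg _, Complex.abs_arg_le_pi _⟩ ⟨h0.le, by linarith [Real.pi_pos]⟩, Real.cos_abs,
      Complex.cos_arg hz', div_lt_iff₀' (norm_pos_iff.2 hz')]
  simp [Delta0, hz, key]

lemma isOpen_Delta0 {r R φ : ℝ} (h0 : 0 < φ) (h1 : φ < Real.pi / 2) : IsOpen (Delta0 r R φ) := by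
  have : Delta0 r R φ = {z : ℂ | ‖z‖ < R} ∩ {z : ℂ | (z - r).re < ‖z - r‖ * Real.cos φ} := by
    ext z
    exact mem_Delta0_iff h0 h1 z
  rw [this]
  exact (isOpen_lt (by fun_prop) (by fun_prop)).inter
    (isOpen_lt (Complex.continuous_re.comp (by fun_prop)) (by fun_prop))

lemma one_sub_div_mem_slitPlane {r R φ : ℝ} (hr : 0 < r) (h0 : 0 < φ) (h1 : φ < Real.pi / 2) {z : ℂ}
    (hz : z ∈ Delta0 r R φ) : 1 - z / r ∈ Complex.slitPlane := by
  have h := ((mem_Delta0_iff h0 h1 z).1 hz).2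
  have hcos : Real.cos φ ≤ 1 := Real.cos_le_one φ
  have hw : 1 - z / r = ((r⁻¹ : ℝ) : ℂ) * (r - z) := by
    have : (r : ℂ) ≠ 0 := by exact_mod_cast hr.ne'
    push_cast
    field_simp
  rw [hw, Complex.mem_slitPlane_iff, Complex.re_ofReal_mul, Complex.im_ofReal_mul]
  by_contra hcon
  push Not at hcon
  have him : (z - r).im = 0 := by
    have := (mul_eq_zero.1 hcon.2).resolve_left (inv_pos.2 hr).ne'
    simpa using this
  have hre : 0 ≤ (z - r).re := by
    have := hcon.1
    have h2 : ((r : ℂ) - z).re ≤ 0 := by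
      by_contra h'
      push Not at h'
      exact absurd (mul_pos (inv_pos.2 hr) h') (not_lt.2 this)
    simp at h2 ⊢
    linarith
  have hn : ‖z - r‖ = (z - r).re := by
    have : z - r = (((z - r).re : ℝ) : ℂ) := Complex.ext rfl him
    rw [this, Complex.norm_real, Real.norm_of_nonneg hre, Complex.ofReal_re]
  rw [hn] at h
  nlinarith

lemma re_sub_neg_of_norm_le {r : ℝ} {z : ℂ} (hz : ‖z‖ ≤ r) (hne : z ≠ r) : (z - r).re < 0 := by
  have h1 : z.re ≤ ‖z‖ := Complex.re_le_norm z
  have : z.re ≠ r := fun h => by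
    have h2 : z.re = ‖z‖ := le_antisymm h1 (hz.trans h.ge)
    have h3 : z.im = 0 := by
      have := Complex.sq_norm z
      rw [← h2, Complex.normSq_apply] at this
      nlinarith
    exact hne (Complex.ext (by simpa using h) (by simpa using h3))
  have h4 : z.re < r := lt_of_le_of_ne (h1.trans hz) this
  simpa using h4

lemma mem_Delta0_of_norm_le {r R φ : ℝ} (hR : r < R) (h0 : 0 < φ) (h1 : φ < Real.pi / 2) {z : ℂ}
    (hz : ‖z‖ ≤ r) (hne : z ≠ r) : z ∈ Delta0 r R φ :=
  (mem_Delta0_iff h0 h1 z).2 ⟨hz.trans_lt hR, (re_sub_neg_of_norm_le hz hne).trans_le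
    (mul_nonneg (norm_nonneg _) (Real.cos_nonneg_of_mem_Icc ⟨by linarith, h1.le⟩))⟩

/-- If `E` is holomorphic in `Δ₀` and `E(t) = O(t - r)` at `r`, then `E'` is bounded on the disc of
radius `r`. -/
theorem exists_bound_deriv {r R φ : ℝ} (hR : r < R) (h0 : 0 < φ) (h1 : φ < Real.pi / 2)
    {E : ℂ → ℂ} (hE : DifferentiableOn ℂ E (Delta0 r R φ))
    (hO : E =O[𝓝[Delta0 r R φ] (r : ℂ)] fun t => t - (r : ℂ)) :
    ∃ M, ∀ z : ℂ, ‖z‖ < r → ‖deriv E z‖ ≤ M := by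
  obtain ⟨C, hC0, hC⟩ := hO.exists_pos
  obtain ⟨δ, hδ, hball⟩ := Metric.mem_nhdsWithin_iff.1 hC.bound
  have hcos : 0 < Real.cos φ := Real.cos_pos_of_mem_Ioo ⟨by linarith, h1⟩
  have hcos1 : Real.cos φ ≤ 1 := Real.cos_le_one φ
  -- For `‖z‖ < r` near `r`, the disc of radius `c‖z - r‖` about `z` stays in the domain: there
  -- `Re(z' - r) < c‖z - r‖` and `‖z' - r‖ ≥ (1 - c)‖z - r‖`, and `c ≤ 2c(1 - c)` as `c ≤ 1/2`.
  -- Cauchy's estimate with `‖E‖ ≤ 2C‖z - r‖` then gives `2C / c`. Away from `r`, compactness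
  -- suffices.
  set c : ℝ := Real.cos φ / 2 with hc
  set η : ℝ := min δ (R - r) / 2 with hη
  have hηpos : 0 < η := half_pos (lt_min hδ (sub_pos.2 hR))
  have hη1 : 2 * η ≤ δ := by rw [hη]; linarith [min_le_left δ (R - r)]
  have hη2 : 2 * η ≤ R - r := by rw [hη]; linarith [min_le_right δ (R - r)]
  have hopen := isOpen_Delta0 (r := r) (R := R) h0 h1
  set S : Set ℂ := Metric.closedBall 0 r ∩ {z | η ≤ ‖z - r‖} with hS
  have hSD : S ⊆ Delta0 r R φ := fun z hz => by
    refine mem_Delta0_of_norm_le hR h0 h1 (by simpa using hz.1) ?_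
    rintro rfl
    have := hz.2
    simp at this
    linarith
  have hScomp : IsCompact S := (isCompact_closedBall _ _).inter_right
    (isClosed_le continuous_const (by fun_prop))
  obtain ⟨M, hM⟩ := hScomp.exists_bound_of_continuousOn
    ((hE.deriv hopen).continuousOn.mono hSD)
  refine ⟨max M (2 * C / c), fun z hz => ?_⟩
  rcases le_or_gt η ‖z - r‖ with hzr | hzr
  · exact (hM z ⟨by simpa using hz.le, hzr⟩).trans (le_max_left _ _)
  refine le_trans ?_ (le_max_right _ _)
  have hne : z ≠ r := by
    rintro rfl
    have h2 : r ≤ ‖(r : ℂ)‖ := by simpa using le_abs_self r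
    linarith
  have hpos : 0 < ‖z - r‖ := norm_pos_iff.2 (sub_ne_zero.2 hne)
  have hneg := re_sub_neg_of_norm_le hz.le hne
  have hcpos : 0 < c := by positivity
  have hsub : ∀ z' ∈ Metric.closedBall z (c * ‖z - r‖), z' ∈ Delta0 r R φ ∧
      ‖z' - r‖ ≤ 2 * ‖z - r‖ := by
    intro z' hz'
    rw [mem_closedBall_iff_norm] at hz'
    have e : z' - r = (z' - z) + (z - r) := by ring
    have e' : z - r = (z' - r) - (z' - z) := by ring
    have hup : ‖z' - r‖ ≤ 2 * ‖z - r‖ := by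
      have := norm_add_le (z' - z) (z - r)
      rw [← e] at this
      nlinarith
    have hlow : ‖z - r‖ ≤ ‖z' - r‖ + c * ‖z - r‖ := by
      have := norm_sub_le (z' - r) (z' - z)
      rw [← e'] at this
      linarith
    refine ⟨(mem_Delta0_iff h0 h1 z').2 ⟨?_, ?_⟩, hup⟩
    · have h5 : ‖z'‖ ≤ ‖z' - z‖ + ‖z‖ := by
        simpa using norm_add_le (z' - z) z
      nlinarith
    · have h6 : (z' - r).re = (z' - z).re + (z - r).re := by rw [e, Complex.add_re]
      have h7 : (z' - z).re ≤ ‖z' - z‖ := Complex.re_le_norm _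
      have h8 : Real.cos φ = 2 * c := by rw [hc]; ring
      rw [h6, h8]
      have h9 := mul_le_mul_of_nonneg_left hlow hcpos.le
      have h10 : 0 ≤ c * ‖z - r‖ * (1 - 2 * c) :=
        mul_nonneg (mul_pos hcpos hpos).le (by linarith)
      nlinarith
  have hd : DiffContOnCl ℂ E (Metric.ball z (c * ‖z - r‖)) := by
    refine DifferentiableOn.diffContOnCl (hE.mono fun z' hz' => ?_)
    exact (hsub z' (Metric.closure_ball_subset_closedBall hz')).1
  have hb := Complex.norm_deriv_le_of_forall_mem_sphere_norm_le (C := 2 * C * ‖z - r‖)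
    (mul_pos hcpos hpos) hd fun z' hz' => by
      have h2 := hsub z' (Metric.sphere_subset_closedBall hz')
      have h3 : z' ∈ Metric.ball (r : ℂ) δ := by
        rw [mem_ball_iff_norm]
        linarith
      have h4 : ‖E z'‖ ≤ C * ‖z' - r‖ := hball ⟨h3, h2.1⟩
      nlinarith
  refine hb.trans_eq ?_
  field_simp

lemma coeff_eq_of_hasSum {a b : ℕ → ℂ} {F : ℂ → ℂ}
    (ha : ∀ᶠ z in 𝓝 (0 : ℂ), HasSum (fun n => a n * z ^ n) (F z))
    (hb : ∀ᶠ z in 𝓝 (0 : ℂ), HasSum (fun n => b n * z ^ n) (F z)) : a = b := by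
  have h : ∀ c : ℕ → ℂ, (∀ᶠ z in 𝓝 (0 : ℂ), HasSum (fun n => c n * z ^ n) (F z)) →
      HasFPowerSeriesAt F (FormalMultilinearSeries.ofScalars ℂ c) 0 := fun c hc => by
    rw [hasFPowerSeriesAt_iff]
    filter_upwards [hc] with z hz
    simpa [FormalMultilinearSeries.coeff_ofScalars, mul_comm] using hz
  have heq := (h a ha).eq_formalMultilinearSeries (h b hb)
  funext n
  have := congrArg (fun p => FormalMultilinearSeries.coeff p n) heq
  simpa [FormalMultilinearSeries.coeff_ofScalars] using this

lemma inv_mem_slitPlane {w : ℂ} (hw : w ∈ Complex.slitPlane) : w⁻¹ ∈ Complex.slitPlane := by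
  have h := Complex.normSq_pos.2 (Complex.slitPlane_ne_zero hw)
  rw [Complex.mem_slitPlane_iff] at hw ⊢
  rw [Complex.inv_re, Complex.inv_im]
  exact hw.imp (fun h' => div_pos h' h) fun h' => div_ne_zero (neg_ne_zero.2 h') h.ne'

/-- Coefficient asymptotics of a function of class `𝓕(r, θ)`. -/
theorem tendsto_exp_neg_mul_pow {α : ℕ → ℝ} {r θ : ℝ} (hg : IsClassF (gAlpha α) r θ) :
    Tendsto (fun m => Real.exp (-α m) * r ^ m) atTop (𝓝 θ) := by
  obtain ⟨hr, -, R, φ, hR, h0, h1, f, hf, hfd, K, hO⟩ := hg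
  have hrC : (r : ℂ) ≠ 0 := by exact_mod_cast hr.ne'
  set E : ℂ → ℂ := fun t => f t - ((θ : ℂ) * Complex.log (1 / (1 - t / (r : ℂ))) + K) with hE
  have hEd : DifferentiableOn ℂ E (Delta0 r R φ) := by
    refine hfd.sub (DifferentiableOn.add_const _ (DifferentiableOn.const_mul ?_ _))
    refine DifferentiableOn.clog ?_ fun z hz => ?_
    · refine DifferentiableOn.div (by fun_prop) (by fun_prop) fun z hz => ?_
      exact Complex.slitPlane_ne_zero (one_sub_div_mem_slitPlane hr h0 h1 hz)
    · rw [one_div]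
      exact inv_mem_slitPlane (one_sub_div_mem_slitPlane hr h0 h1 hz)
  obtain ⟨M, hM⟩ := exists_bound_deriv hR h0 h1 hEd hO
  have hballD : Metric.ball (0 : ℂ) r ⊆ Delta0 r R φ := fun z hz => by
    rw [mem_ball_zero_iff] at hz
    refine mem_Delta0_of_norm_le hR h0 h1 hz.le ?_
    rintro rfl
    have h2 : r ≤ ‖(r : ℂ)‖ := by simpa using le_abs_self r
    linarith
  have hEb : DifferentiableOn ℂ E (Metric.ball 0 r) := hEd.mono hballD
  have hE'b : DifferentiableOn ℂ (deriv E) (Metric.ball 0 r) := hEb.deriv Metric.isOpen_ball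
  -- Passing to `E'` supplies the factor `m` that cancels the `1 / m` in the coefficients of both
  -- `g` and the logarithm.
  have hlim := tendsto_coeff_of_bounded (a := fun n => ((n.factorial : ℂ))⁻¹ * iteratedDeriv n (deriv E) 0)
    hr (fun z hz => by
      have := Complex.hasSum_taylorSeries_on_ball hE'b (mem_ball_zero_iff.2 hz)
      simpa [mul_assoc, mul_comm, mul_left_comm] using this) hM
  -- The series is only known to represent `f` near `0`, which is enough to identify coefficients.
  -- At `n = 0` the division by zero gives the logarithm's constant term `0`.
  have hcoef : (fun n : ℕ => PowerSeries.coeff n (gAlpha α) - (θ * ((r : ℂ)⁻¹ ^ n / n) + if n = 0 then K else 0)) =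
      fun n : ℕ => ((n.factorial : ℂ))⁻¹ * iteratedDeriv n E 0 := by
    refine coeff_eq_of_hasSum (F := E) ?_ ?_
    · filter_upwards [hf, Metric.ball_mem_nhds (0 : ℂ) hr] with z hz hzr
      rw [mem_ball_zero_iff] at hzr
      have hzr' : ‖z / r‖ < 1 := by
        rw [norm_div, Complex.norm_real, Real.norm_of_nonneg hr.le, div_lt_one hr]
        exact hzr
      have hl := (Complex.hasSum_taylorSeries_neg_log hzr').mul_left (θ : ℂ)
      have hlog : Complex.log (1 / (1 - z / r)) = -Complex.log (1 - z / r) := by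
        rw [one_div, Complex.log_inv]
        exact Complex.slitPlane_arg_ne_pi (one_sub_div_mem_slitPlane hr h0 h1
          (hballD (mem_ball_zero_iff.2 hzr)))
      have hk := hasSum_ite_eq 0 K
      simp only [hE]
      rw [hlog]
      refine Eq.mp ?_ (hz.sub (hl.add hk))
      congr 1
      funext n
      rw [sub_mul, add_mul, ite_mul, zero_mul, div_pow, inv_pow]
      congr 2
      · field_simp
      · split_ifs with hn <;> simp [hn]
    · filter_upwards [Metric.ball_mem_nhds (0 : ℂ) hr] with z hz
      have := Complex.hasSum_taylorSeries_on_ball hEb hz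
      simpa [mul_assoc, mul_comm, mul_left_comm] using this
  have hfin : ∀ n : ℕ, ((n.factorial : ℂ))⁻¹ * iteratedDeriv n (deriv E) 0 * (r : ℂ) ^ n * r + θ =
      ((Real.exp (-α (n + 1)) * r ^ (n + 1) : ℝ) : ℂ) := by
    intro n
    have h2 := congrFun hcoef (n + 1)
    simp only [gAlpha, PowerSeries.coeff_mk, Nat.add_eq_zero_iff, one_ne_zero, and_false, if_false,
      add_zero, iteratedDeriv_succ'] at h2
    have hn : ((n : ℂ) + 1) ≠ 0 := by exact_mod_cast Nat.succ_ne_zero n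
    have hfac : ((n.factorial : ℂ)) ≠ 0 := by exact_mod_cast n.factorial_ne_zero
    rw [Nat.factorial_succ] at h2
    push_cast at h2 ⊢
    have h3 : ((n.factorial : ℂ))⁻¹ * iteratedDeriv n (deriv E) 0 =
        ((n : ℂ) + 1) * ((((n : ℂ) + 1) * (n.factorial : ℂ))⁻¹ * iteratedDeriv n (deriv E) 0) := by
      field_simp
    rw [h3, ← h2, inv_pow, pow_succ]
    field_simp
    ring
  have hlim2 := ((hlim.mul_const (r : ℂ)).add_const (θ : ℂ)).congr hfin
  rw [zero_mul, zero_add] at hlim2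
  rw [← tendsto_add_atTop_iff_nat 1]
  exact Complex.continuous_re.continuousAt.tendsto.comp hlim2

/-! ### The law of the cycle counts -/

lemma normConst_pow (x : ℕ → ℝ) (n : ℕ) : normConst (fun m c => x m ^ c) n = expCoeff x n :=
  normConst_eq_coeff _ _

/-- The correction of the generating series when the number of cycles of length `m` is fixed to
be `c`. -/
def fixedCycleSeries (m c : ℕ) (x : ℝ) : PowerSeries ℝ :=
  (cycleSeries m fun j => if j = c then x ^ j else 0) * expCycleSeries m (-x)

lemma sum_permWeight_fixed {b n : ℕ} (hbn : b ≤ n) (x : ℕ → ℝ) (c : ℕ → ℕ) :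
    (1 / (n.factorial : ℝ)) * ∑ σ : Equiv.Perm (Fin n) with ∀ j < b, cycleCount (j + 1) σ = c j,
        permWeight (fun m k => x m ^ k) n σ =
      PowerSeries.coeff n ((∏ j ∈ Finset.range b, fixedCycleSeries (j + 1) (c j) (x (j + 1))) *
        ∏ m ∈ Finset.Icc 1 n, expCycleSeries m (x m)) := by
  -- The indicator of the event factors over cycle lengths, so it can be absorbed into the weights
  -- and the exponential formula applies again. Since `c` is indexed from `0`, length `m` uses `c (m
  -- - 1)`.
  set F : ℕ → ℕ → ℝ := fun m k => if m ≤ b then (if k = c (m - 1) then x m ^ k else 0) else x m ^ k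
    with hF
  have hw : ∀ σ : Equiv.Perm (Fin n), permWeight F n σ =
      if ∀ j < b, cycleCount (j + 1) σ = c j then permWeight (fun m k => x m ^ k) n σ else 0 := by
    intro σ
    split_ifs with h
    · refine Finset.prod_congr rfl fun m hm => ?_
      rw [Finset.mem_Icc] at hm
      simp only [hF]
      split_ifs with h1 h2
      · rfl
      · refine absurd ?_ h2
        have := h (m - 1) (by omega)
        rwa [Nat.sub_add_cancel hm.1] at this
      · rfl
    · push Not at h
      obtain ⟨j, hj, hne⟩ := h
      refine Finset.prod_eq_zero (i := j + 1) (Finset.mem_Icc.2 (by omega)) ?_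
      simp only [hF]
      rw [if_pos (by omega), if_neg (by simpa using hne)]
  rw [Finset.sum_filter, ← Finset.sum_congr rfl fun σ _ => hw σ]
  change normConst F n = _
  rw [normConst_eq_coeff]
  congr 1
  have hfac : ∀ m ∈ Finset.Icc 1 n, cycleSeries m (F m) =
      (if m ≤ b then fixedCycleSeries m (c (m - 1)) (x m) else 1) * expCycleSeries m (x m) := by
    intro m hm
    rw [Finset.mem_Icc] at hm
    split_ifs with h
    · rw [fixedCycleSeries, mul_assoc, mul_comm (expCycleSeries m (-x m)),
        expCycleSeries_mul_neg hm.1, mul_one]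
      simp only [hF, if_pos h]
    · rw [one_mul, expCycleSeries]
      simp only [hF, if_neg h]
  rw [Finset.prod_congr rfl hfac, Finset.prod_mul_distrib]
  congr 1
  rw [← Finset.prod_filter]
  refine (Finset.prod_nbij' (fun j => j + 1) (fun m => m - 1) ?_ ?_ ?_ ?_ ?_).symm
  · intro j hj
    simp at hj ⊢
    omega
  · intro m hm
    simp at hm ⊢
    omega
  · simp
  · intro m hm
    simp at hm ⊢
    omega
  · simp

theorem tendsto_fixed_div_expCoeff {x : ℕ → ℝ} {ρ : ℝ} (hx : ∀ m, 1 ≤ m → 0 < x m)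
    (hρ : Tendsto (fun n => expCoeff x n / expCoeff x (n + 1)) atTop (𝓝 ρ)) (b : ℕ) (c : ℕ → ℕ) :
    Tendsto (fun n => PowerSeries.coeff n
        ((∏ j ∈ Finset.range b, fixedCycleSeries (j + 1) (c j) (x (j + 1))) *
          ∏ m ∈ Finset.Icc 1 n, expCycleSeries m (x m)) / expCoeff x n) atTop
      (𝓝 (∏ j ∈ Finset.range b,
        ((x (j + 1) * ρ ^ (j + 1) / ((j + 1 : ℕ) : ℝ)) ^ c j / ((c j).factorial : ℝ) *
          Real.exp (-(x (j + 1) * ρ ^ (j + 1) / ((j + 1 : ℕ) : ℝ)))))) := by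
  have hpos := expCoeff_pos hx
  -- Replacing the product, which depends on `n`, by the fixed series of the `h_k` allows the
  -- factors of `q` to be added one at a time by induction on `b`.
  have hcongr : ∀ n (A : PowerSeries ℝ), PowerSeries.coeff n
      (A * ∏ m ∈ Finset.Icc 1 n, expCycleSeries m (x m)) =
        PowerSeries.coeff n (A * PowerSeries.mk (expCoeff x)) := fun n A =>
    coeff_mul_congr fun k hk => by
      rw [coeff_prod_expCycleSeries x hk, PowerSeries.coeff_mk]
  simp_rw [hcongr]
  induction b with
  | zero =>
    simp only [Finset.range_zero, Finset.prod_empty, one_mul, PowerSeries.coeff_mk]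
    simp [fun n => (hpos n).ne']
  | succ b ih =>
    simp_rw [Finset.prod_range_succ]
    have hb : 0 < b + 1 := by omega
    have h1 := tendsto_coeff_mul_div hpos hρ
      (summable_abs_expCycleSeries hb (-x (b + 1))) ih
      (hasSum_expCycleSeries hb (-x (b + 1)) ρ)
    have h2 := tendsto_coeff_mul_div hpos hρ
      (summable_abs_cycleSeries_single hb (c b) (x (b + 1))) h1
      (hasSum_cycleSeries_single hb (c b) (x (b + 1)) ρ)
    convert h2 using 2
    · congr 2
      rw [fixedCycleSeries]
      ring
    · rw [neg_mul, neg_div, mul_comm (Finset.prod _ _), mul_assoc]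

lemma weightedMeasure_apply (F : ℕ → ℕ → ℝ) (n : ℕ) (p : Equiv.Perm (Fin n) → Prop)
    [DecidablePred p] (hF : ∀ σ, 0 ≤ permWeight F n σ) :
    weightedMeasure F n {σ | p σ} = ENNReal.ofReal
      ((1 / (n.factorial : ℝ)) * (∑ σ : Equiv.Perm (Fin n) with p σ, permWeight F n σ) /
        normConst F n) := by
  have hN : 0 ≤ normConst F n :=
    mul_nonneg (by positivity) (Finset.sum_nonneg fun σ _ => hF σ)
  have e : (1 / (n.factorial : ℝ)) * (∑ σ : Equiv.Perm (Fin n) with p σ, permWeight F n σ) /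
      normConst F n = ∑ σ : Equiv.Perm (Fin n) with p σ,
        1 / ((n.factorial : ℝ) * normConst F n) * permWeight F n σ := by
    rw [← Finset.mul_sum]
    ring
  rw [e, ENNReal.ofReal_sum_of_nonneg fun σ _ => mul_nonneg (by positivity) (hF σ),
    weightedMeasure, Measure.finsetSum_apply, Finset.sum_filter]
  refine Finset.sum_congr rfl fun σ _ => ?_
  rw [Measure.smul_apply, Measure.dirac_apply' _ (MeasurableSpace.measurableSet_top)]
  by_cases h : p σ <;> simp [h]

lemma isProbabilityMeasure_weightedMeasure {F : ℕ → ℕ → ℝ} {n : ℕ}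
    (hF : ∀ σ, 0 ≤ permWeight F n σ) (hN : normConst F n ≠ 0) :
    IsProbabilityMeasure (weightedMeasure F n) := by
  constructor
  have h := weightedMeasure_apply F n (fun _ => True) hF
  rw [Set.ofPred_true, Finset.filter_true] at h
  rw [h, ← ENNReal.ofReal_one]
  congr 1
  exact div_self hN

/-! ### Weak convergence on countable discrete spaces -/

/-- Convergence of the point masses implies weak convergence. -/
theorem tendsto_of_tendsto_singleton {E : Type*} [Countable E] [TopologicalSpace E]
    [MeasurableSpace E] [OpensMeasurableSpace E] [MeasurableSingletonClass E]
    {μ : ProbabilityMeasure E} {μs : ℕ → ProbabilityMeasure E}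
    (h : ∀ c, Tendsto (fun n => (μs n : Measure E) {c}) atTop (𝓝 ((μ : Measure E) {c}))) :
    Tendsto μs atTop (𝓝 μ) := by
  -- Fatou for counting measure gives the portmanteau inequality on open sets; no separate tightness
  -- argument is needed, as the limit is already a probability measure.
  refine tendsto_of_forall_isOpen_le_liminf' fun U _ => ?_
  have hmeas : MeasurableSet U := U.to_countable.measurableSet
  have key : ∀ ν : Measure E, ν U = ∫⁻ c in U, ν {c} ∂Measure.count := fun ν => by
    rw [← lintegral_indicator hmeas, lintegral_count,
      Measure.tsum_indicator_apply_singleton ν U hmeas]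
  simp_rw [key]
  rw [lintegral_congr fun c => ((h c).liminf_eq).symm]
  exact lintegral_liminf_le fun n => measurable_of_countable _

/-! ### The Fourier weights -/

section Fourier

variable {d : ℕ} {ξ : EuclideanSpace ℝ (Fin d) → ℝ}

lemma expNegEps_zero (ξ : EuclideanSpace ℝ (Fin d) → ℝ) :
    expNegEps ξ 0 = ∫ x, Real.exp (-ξ x) := by
  have : fourierWeight ξ 0 = ((∫ x, Real.exp (-ξ x) : ℝ) : ℂ) := by
    rw [← integral_complex_ofReal]
    simp [fourierWeight]
  rw [expNegEps, this, Complex.ofReal_re]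

lemma expNegEps_zero_pos (hξint : Integrable (fun x => Real.exp (-ξ x))) :
    0 < expNegEps ξ 0 := by
  rw [expNegEps_zero]
  exact integral_exp_pos hξint

/-- The character has modulus `1`, so the integral is largest at `k = 0`; hence the minimum `r̃` is
attained there. -/
lemma expNegEps_le_zero (ξ : EuclideanSpace ℝ (Fin d) → ℝ) (k : EuclideanSpace ℝ (Fin d)) :
    expNegEps ξ k ≤ expNegEps ξ 0 := by
  rw [expNegEps_zero]
  refine (Complex.re_le_norm _).trans ((norm_integral_le_integral_norm _).trans_eq ?_)
  refine integral_congr_ae (Eventually.of_forall fun x => ?_)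
  have : ‖Complex.exp (-2 * (Real.pi : ℂ) * Complex.I * ((inner ℝ k x : ℝ) : ℂ))‖ = 1 := by
    rw [Complex.norm_exp]
    simp
  simp only [norm_mul, this, mul_one, Complex.norm_real, Real.norm_eq_abs, Real.abs_exp]

variable {Λ : Submodule ℤ (EuclideanSpace ℝ (Fin d))}

lemma isLeast_rTilde (hξint : Integrable (fun x => Real.exp (-ξ x))) :
    IsLeast (expEpsSet ξ Λ) (rTilde ξ Λ) ∧ rTilde ξ Λ = (expNegEps ξ 0)⁻¹ := by
  have h : IsLeast (expEpsSet ξ Λ) (expNegEps ξ 0)⁻¹ := by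
    refine ⟨⟨0, Λ.zero_mem, expNegEps_zero_pos hξint, rfl⟩, ?_⟩
    rintro _ ⟨k, -, hk, rfl⟩
    exact inv_anti₀ hk (expNegEps_le_zero ξ k)
  have e : rTilde ξ Λ = (expNegEps ξ 0)⁻¹ := h.csInf_eq
  exact ⟨e ▸ h, e⟩

lemma summable_expNegEps_pow (hnn : ∀ k ∈ Λ, 0 ≤ expNegEps ξ k)
    (hsum : Summable fun k : Λ => expNegEps ξ (k : EuclideanSpace ℝ (Fin d))) {m : ℕ}
    (hm : 1 ≤ m) : Summable fun k : Λ => expNegEps ξ (k : EuclideanSpace ℝ (Fin d)) ^ m := by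
  obtain ⟨l, rfl⟩ : ∃ l, m = l + 1 := ⟨m - 1, by omega⟩
  refine Summable.of_nonneg_of_le (fun k => pow_nonneg (hnn k k.2) _) (fun k => ?_)
    (hsum.mul_left (expNegEps ξ 0 ^ l))
  rw [pow_succ]
  exact mul_le_mul_of_nonneg_right
    (pow_le_pow_left₀ (hnn k k.2) (expNegEps_le_zero ξ k) l) (hnn k k.2)

lemma pow_le_tsum_expNegEps (hnn : ∀ k ∈ Λ, 0 ≤ expNegEps ξ k)
    (hsum : Summable fun k : Λ => expNegEps ξ (k : EuclideanSpace ℝ (Fin d))) {m : ℕ}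
    (hm : 1 ≤ m) :
    expNegEps ξ 0 ^ m ≤ ∑' k : Λ, expNegEps ξ (k : EuclideanSpace ℝ (Fin d)) ^ m :=
  (summable_expNegEps_pow hnn hsum hm).le_tsum (0 : Λ) fun k _ => pow_nonneg (hnn k k.2) _

lemma spatialFactor_pos (hξint : Integrable (fun x => Real.exp (-ξ x)))
    (hnn : ∀ k ∈ Λ, 0 ≤ expNegEps ξ k)
    (hsum : Summable fun k : Λ => expNegEps ξ (k : EuclideanSpace ℝ (Fin d)))
    (α : ℕ → ℝ) {m : ℕ} (hm : 1 ≤ m) : 0 < spatialFactor α ξ Λ m :=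
  mul_pos (Real.exp_pos _)
    ((pow_pos (expNegEps_zero_pos hξint) m).trans_le (pow_le_tsum_expNegEps hnn hsum hm))

/-- Normalized by the value at `k = 0`, the terms lie in `[0, 1]`, and their powers tend to `1` at
maximizers and to `0` elsewhere, dominated by the first powers. -/
lemma exists_tendsto_spatialFactor_mul_pow (hξint : Integrable (fun x => Real.exp (-ξ x)))
    (hnn : ∀ k ∈ Λ, 0 ≤ expNegEps ξ k)
    (hsum : Summable fun k : Λ => expNegEps ξ (k : EuclideanSpace ℝ (Fin d)))
    {α : ℕ → ℝ} {r θ : ℝ} (hθ : 0 < θ)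
    (hα : Tendsto (fun m => Real.exp (-α m) * r ^ m) atTop (𝓝 θ)) :
    ∃ c > 0, Tendsto (fun m => spatialFactor α ξ Λ m * (r * rTilde ξ Λ) ^ m) atTop (𝓝 c) := by
  have h0 := expNegEps_zero_pos hξint
  set a : Λ → ℝ := fun k => expNegEps ξ (k : EuclideanSpace ℝ (Fin d)) / expNegEps ξ 0 with ha
  have ha0 : ∀ k, 0 ≤ a k := fun k => div_nonneg (hnn k k.2) h0.le
  have ha1 : ∀ k, a k ≤ 1 := fun k => (div_le_one h0).2 (expNegEps_le_zero ξ k)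
  have hlim : Tendsto (fun m => ∑' k, a k ^ m) atTop (𝓝 (∑' k, if a k = 1 then 1 else 0)) := by
    refine tendsto_tsum_of_dominated_convergence (bound := a) (hsum.div_const _) (fun k => ?_) ?_
    · split_ifs with h
      · simp [h]
      · exact tendsto_pow_atTop_nhds_zero_of_lt_one (ha0 k) (lt_of_le_of_ne (ha1 k) h)
    · filter_upwards [eventually_ge_atTop 1] with m hm k
      rw [Real.norm_of_nonneg (pow_nonneg (ha0 k) m)]
      exact pow_le_of_le_one (ha0 k) (ha1 k) (by omega)
  have hpow : ∀ m, ∑' k, a k ^ m =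
      (∑' k : Λ, expNegEps ξ (k : EuclideanSpace ℝ (Fin d)) ^ m) / expNegEps ξ 0 ^ m := fun m => by
    rw [← tsum_div_const]
    simp only [ha, div_pow]
  have hge : (1 : ℝ) ≤ ∑' k, if a k = 1 then 1 else 0 := by
    refine ge_of_tendsto hlim ?_
    filter_upwards [eventually_ge_atTop 1] with m hm
    rw [hpow, one_le_div (pow_pos h0 m)]
    exact pow_le_tsum_expNegEps hnn hsum hm
  refine ⟨θ * ∑' k, if a k = 1 then 1 else 0, mul_pos hθ (by linarith), ?_⟩
  refine (hα.mul hlim).congr fun m => ?_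
  rw [hpow, spatialFactor, (isLeast_rTilde (Λ := Λ) hξint).2, mul_pow, inv_pow]
  field_simp

end Fourier

end SpatialPerm

end

/-! ### Convergence of the joint law of the cycle counts -/

theorem mainTheorem11
    {d : ℕ} (ξ : EuclideanSpace ℝ (Fin d) → ℝ) (hξ : Continuous ξ)
    (hξint : Integrable (fun x => Real.exp (-ξ x)))
    (Λ : Submodule ℤ (EuclideanSpace ℝ (Fin d))) [DiscreteTopology Λ] [IsZLattice ℝ Λ]
    (hε : ∀ k ∈ Λ, 0 ≤ (SpatialPerm.fourierWeight ξ k).re ∧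
      (SpatialPerm.fourierWeight ξ k).im = 0)
    (hsum : Summable fun k : Λ => SpatialPerm.expNegEps ξ (k : EuclideanSpace ℝ (Fin d)))
    (α : ℕ → ℝ) (r θ : ℝ) (hθ : 0 < θ)
    (hg : SpatialPerm.IsClassF (SpatialPerm.gAlpha α) r θ)
    (b : ℕ) :
    -- the objects in the claim are well defined
    IsLeast (SpatialPerm.expEpsSet ξ Λ) (SpatialPerm.rTilde ξ Λ) ∧
    (∀ m : ℕ, 1 ≤ m →
      Summable fun k : Λ => SpatialPerm.expNegEps ξ (k : EuclideanSpace ℝ (Fin d)) ^ m) ∧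
    ∃ _ : ∀ n : ℕ, IsProbabilityMeasure (SpatialPerm.spatialMeasure α ξ Λ n),
      -- convergence in distribution of `(C_1, …, C_b)` to any vector `(Y_1, …, Y_b)` of
      -- independent Poisson variables with the stated means (`Y_{j+1}` is `Y j`, `j < b`)
      ∀ {Ω : Type*} [MeasurableSpace Ω] (P : Measure Ω) [IsProbabilityMeasure P]
        (Y : Fin b → Ω → ℕ),
        iIndepFun Y P →
        (∀ j : Fin b, HasLaw (Y j)
          (poissonMeasure (Real.toNNReal
            ((r * SpatialPerm.rTilde ξ Λ) ^ (j.val + 1) / ((j.val + 1 : ℕ) : ℝ) *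
              SpatialPerm.spatialFactor α ξ Λ (j.val + 1)))) P) →
        TendstoInDistribution
          (fun (n : ℕ) (σ : Equiv.Perm (Fin n)) (j : Fin b) =>
            SpatialPerm.cycleCount (j.val + 1) σ)
          atTop (fun ω j => Y j ω) (fun n : ℕ => SpatialPerm.spatialMeasure α ξ Λ n) P := by
  have hnn : ∀ k ∈ Λ, 0 ≤ SpatialPerm.expNegEps ξ k := fun k hk => (hε k hk).1
  set x := SpatialPerm.spatialFactor α ξ Λ with hxdef
  set ρ := r * SpatialPerm.rTilde ξ Λ with hρdef
  have hx : ∀ m, 1 ≤ m → 0 < x m := fun m hm =>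
    SpatialPerm.spatialFactor_pos hξint hnn hsum α hm
  have hF : SpatialPerm.spatialF α ξ Λ = fun m c => x m ^ c := rfl
  have hw : ∀ n σ, 0 ≤ SpatialPerm.permWeight (SpatialPerm.spatialF α ξ Λ) n σ := fun n σ =>
    Finset.prod_nonneg fun m hm => pow_nonneg (hx m (Finset.mem_Icc.1 hm).1).le _
  have hprob : ∀ n : ℕ, IsProbabilityMeasure (SpatialPerm.spatialMeasure α ξ Λ n) := fun n =>
    SpatialPerm.isProbabilityMeasure_weightedMeasure (hw n) (by
      rw [hF, SpatialPerm.normConst_pow]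
      exact (SpatialPerm.expCoeff_pos hx n).ne')
  refine ⟨(SpatialPerm.isLeast_rTilde hξint).1,
    fun m hm => SpatialPerm.summable_expNegEps_pow hnn hsum hm, hprob, ?_⟩
  intro Ω _ P _ Y hindep hlaw
  have hρpos : 0 < ρ := by
    rw [hρdef, (SpatialPerm.isLeast_rTilde (Λ := Λ) hξint).2]
    exact mul_pos hg.1 (inv_pos.2 (SpatialPerm.expNegEps_zero_pos hξint))
  obtain ⟨c₀, hc₀, hlim⟩ := SpatialPerm.exists_tendsto_spatialFactor_mul_pow hξint hnn hsum hθ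
    (SpatialPerm.tendsto_exp_neg_mul_pow hg)
  have hratio := SpatialPerm.tendsto_expCoeff_ratio hx hρpos hc₀ hlim
  have hYm : ∀ j, AEMeasurable (Y j) P := fun j => (hlaw j).aemeasurable
  have hXm : ∀ n : ℕ, Measurable (fun (σ : Equiv.Perm (Fin n)) (j : Fin b) =>
      SpatialPerm.cycleCount (j.val + 1) σ) := fun n => measurable_from_top
  refine ⟨fun n => (hXm n).aemeasurable, aemeasurable_pi_lambda _ hYm, ?_⟩
  -- `Fin b → ℕ` is countable, so only point masses need to be compared.
  refine SpatialPerm.tendsto_of_tendsto_singleton fun c => ?_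
  -- Extension by `0`, to index products by `Finset.range b`; only values below `b` matter.
  set c' : ℕ → ℕ := fun j => if h : j < b then c ⟨j, h⟩ else 0 with hc'
  have hcj : ∀ j : Fin b, c' j = c j := fun j => by simp [hc']
  have hleft : ∀ n ≥ b, (SpatialPerm.spatialMeasure α ξ Λ n).map
      (fun (σ : Equiv.Perm (Fin n)) (j : Fin b) => SpatialPerm.cycleCount (j.val + 1) σ) {c} =
      ENNReal.ofReal (PowerSeries.coeff n
        ((∏ j ∈ Finset.range b, SpatialPerm.fixedCycleSeries (j + 1) (c' j) (x (j + 1))) *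
          ∏ m ∈ Finset.Icc 1 n, SpatialPerm.expCycleSeries m (x m)) / SpatialPerm.expCoeff x n) := by
    intro n hn
    rw [Measure.map_apply (hXm n) (measurableSet_singleton c)]
    have hset : (fun (σ : Equiv.Perm (Fin n)) (j : Fin b) =>
        SpatialPerm.cycleCount (j.val + 1) σ) ⁻¹' {c} =
        {σ | ∀ j < b, SpatialPerm.cycleCount (j + 1) σ = c' j} := by
      ext σ
      simp only [Set.mem_preimage, Set.mem_singleton_iff, Set.mem_ofPred_eq, funext_iff]
      constructor
      · intro h j hj
        rw [h ⟨j, hj⟩, ← hcj]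
      · intro h j
        rw [h j j.2, hcj]
    rw [hset, SpatialPerm.spatialMeasure, SpatialPerm.weightedMeasure_apply _ _ _ (hw n), hF,
      SpatialPerm.sum_permWeight_fixed hn, SpatialPerm.normConst_pow]
  have hright : P.map (fun ω j => Y j ω) {c} = ENNReal.ofReal (∏ j ∈ Finset.range b,
        ((x (j + 1) * ρ ^ (j + 1) / ((j + 1 : ℕ) : ℝ)) ^ c' j / ((c' j).factorial : ℝ) *
          Real.exp (-(x (j + 1) * ρ ^ (j + 1) / ((j + 1 : ℕ) : ℝ))))) := by
    have hnn' : ∀ j, 0 ≤ x (j + 1) * ρ ^ (j + 1) / ((j + 1 : ℕ) : ℝ) := fun j =>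
      div_nonneg (mul_nonneg (hx _ (by omega)).le (pow_nonneg hρpos.le _)) (by positivity)
    rw [(iIndepFun_iff_map_fun_eq_pi_map hYm).1 hindep, Measure.pi_singleton,
      ENNReal.ofReal_prod_of_nonneg fun j _ => mul_nonneg
        (div_nonneg (pow_nonneg (hnn' j) _) (by positivity)) (Real.exp_pos _).le,
      Finset.prod_range]
    refine Finset.prod_congr rfl fun j _ => ?_
    have e : ρ ^ (j.val + 1) / ((j.val + 1 : ℕ) : ℝ) * x (j.val + 1) =
        x (j + 1) * ρ ^ (j.val + 1) / ((j.val + 1 : ℕ) : ℝ) := by ring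
    rw [(hlaw j).map_eq, poissonMeasure_singleton, e, Real.coe_toNNReal _ (hnn' j), hcj]
    congr 1
    ring
  change Tendsto (fun n => (SpatialPerm.spatialMeasure α ξ Λ n).map _ {c}) atTop
    (𝓝 (P.map (fun ω j => Y j ω) {c}))
  rw [hright]
  refine (ENNReal.tendsto_ofReal
    (SpatialPerm.tendsto_fixed_div_expCoeff hx hratio b c')).congr' ?_
  filter_upwards [eventually_ge_atTop b] with n hn
  exact (hleft n hn).symm
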